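/- All rings are commutative with identity. For a ring $R$ and an integer $n\ge 0$, an $R$-module $M$ is strongly $n$-Gorenstein projective (resp. flat) if there is a short exact sequence $0\to M\to P\to M\to 0$ with $\mathrm{pd}_R(P)\le n$ (resp. $\mathrm{fd}_R(P)\le n$) and $\mathrm{Ext}_R^{n+1}(M,Q)=0$ for every projective module $Q$ (resp. $\mathrm{Tor}^R_{n+1}(M,I)=0$ for every injective module $I$). The ring $R$ is $n$-SG (resp. $n$-wSG) if every $R$-module is strongly $n$-Gorenstein projective (resp. strongly $n$-Gorenstein flat). Let $\mathrm{Ggldim}(R)$ (resp. $\mathrm{wGgldim}(R)$) be the supremum of the Gorenstein projective (resp. Gorenstein flat) dimensions of all $R$-modules, and let $\mathrm{gldim}(R)$ and $\mathrm{wdim}(R)$ be the global and weak global dimensions of $R$. Let $K$ be a field, $R_1:=K[X]/(X^2)$ and $R_2:=K[X]/(X^3)$; these are non-semisimple quasi-Frobenius rings. Then: 1. $\mathrm{Ggldim}(R_1)=\mathrm{Ggldim}(R_2)=0$, and $R_1$ is a $0$-SG ring but $R_2$ is not. Let $n\ge 0$ and let $S$ be a non-Noetherian ring with $\mathrm{gldim}(S)=n$.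 Then: 2. $R_1\times S$ is a non-Noetherian $n$-SG (and also $n$-wSG) ring with $\mathrm{wdim}(R_1\times S)=\infty$. 3. $\mathrm{Ggldim}(R_2\times S)=n$, but $R_2\times S$ is not $n$-SG; moreover $R_2\times S$ is non-Noetherian and $\mathrm{wdim}(R_2\times S)=\infty$. For every $n\ge 0$ (independently of $S$): 4. $\mathrm{wGgldim}(R_2[X_1,\dots,X_n])=\mathrm{Ggldim}(R_2[X_1,\dots,X_n])=n$, but $R_2[X_1,\dots,X_n]$ is neither $n$-SG nor $n$-wSG; moreover $\mathrm{wdim}(R_2[X_1,\dots,X_n])=\infty$. -/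

import Mathlib

universe u

open CategoryTheory

noncomputable section

namespace StronglyGorenstein

/- For a commutative ring `R : Type u`, "`R`-module" means an object of `ModuleCat.{u} R`,
i.e. an `R`-module in the universe of `R`. -/
variable (R : Type u) [CommRing R]

/-- `HasResolutionLE R C n M`: there is an exact sequence
`0 → X n → ⋯ → X 1 → X 0 → M → 0` of `R`-modules with all `X i` in the class `C`.
(The class `C` is meant to be closed under isomorphism.)  The sequence is cut into its
short exact pieces `0 → ker p → X → M → 0`. -/
def HasResolutionLE (C : ModuleCat.{u} R → Prop) : ℕ → ModuleCat.{u} R → Prop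
  | 0, M => C M
  | n + 1, M => ∃ (X : ModuleCat.{u} R) (p : X →ₗ[R] M), C X ∧ Function.Surjective p ∧
      HasResolutionLE C n (ModuleCat.of R (LinearMap.ker p))

/-- The least length of a resolution of `M` by modules in the class `C`;
it is `⊤` if there is no finite one. -/
def resolutionDim (C : ModuleCat.{u} R → Prop) (M : ModuleCat.{u} R) : ℕ∞ :=
  ⨅ (n : ℕ) (_ : HasResolutionLE R C n M), (n : ℕ∞)

/-- `M` is Gorenstein projective: it is (isomorphic to) the image of a map in an exact sequence
`⋯ → P (-1) → P 0 → P 1 → ⋯` of projective modules that stays exact under `Hom_R(-, Q)`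
for every projective module `Q`. -/
def IsGorensteinProjective (M : ModuleCat.{u} R) : Prop :=
  ∃ (P : ℤ → ModuleCat.{u} R) (d : ∀ i : ℤ, P i →ₗ[R] P (i + 1)),
    (∀ i, Module.Projective R (P i)) ∧
    (∀ i, Function.Exact (d i) (d (i + 1))) ∧
    (∀ Q : ModuleCat.{u} R, Module.Projective R Q →
      ∀ i, Function.Exact (LinearMap.lcomp R Q (d (i + 1))) (LinearMap.lcomp R Q (d i))) ∧
    Nonempty (M ≃ₗ[R] LinearMap.range (d 0))

/-- `M` is Gorenstein flat: it is (isomorphic to) the image of a map in an exact sequence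
`⋯ → F (-1) → F 0 → F 1 → ⋯` of flat modules that stays exact under `- ⊗_R I`
for every injective module `I`. -/
def IsGorensteinFlat (M : ModuleCat.{u} R) : Prop :=
  ∃ (F : ℤ → ModuleCat.{u} R) (d : ∀ i : ℤ, F i →ₗ[R] F (i + 1)),
    (∀ i, Module.Flat R (F i)) ∧
    (∀ i, Function.Exact (d i) (d (i + 1))) ∧
    (∀ I : ModuleCat.{u} R, Module.Injective R I →
      ∀ i, Function.Exact ((d i).rTensor I) ((d (i + 1)).rTensor I)) ∧
    Nonempty (M ≃ₗ[R] LinearMap.range (d 0))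

/-- The flat dimension of `M` is at most `n`. -/
def HasFlatDimensionLE (n : ℕ) (M : ModuleCat.{u} R) : Prop :=
  HasResolutionLE R (fun F => Module.Flat R F) n M

/-- The flat dimension `fd_R(M)`. -/
def flatDimension (M : ModuleCat.{u} R) : ℕ∞ :=
  resolutionDim R (fun F => Module.Flat R F) M

/-- The Gorenstein projective dimension `Gpd_R(M)`. -/
def gorensteinProjectiveDimension (M : ModuleCat.{u} R) : ℕ∞ :=
  resolutionDim R (IsGorensteinProjective R) M

/-- The Gorenstein flat dimension `Gfd_R(M)`. -/
def gorensteinFlatDimension (M : ModuleCat.{u} R) : ℕ∞ :=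
  resolutionDim R (IsGorensteinFlat R) M

/-- The global dimension `gldim(R)` (with value `⊥` for the zero ring). -/
def gldim : WithBot ℕ∞ := ⨆ M : ModuleCat.{u} R, projectiveDimension M

/-- The weak global dimension `wdim(R)`. -/
def wdim : ℕ∞ := ⨆ M : ModuleCat.{u} R, flatDimension R M

/-- The Gorenstein global dimension `Ggldim(R)`. -/
def Ggldim : ℕ∞ := ⨆ M : ModuleCat.{u} R, gorensteinProjectiveDimension R M

/-- The weak Gorenstein global dimension `wGgldim(R)`. -/
def wGgldim : ℕ∞ := ⨆ M : ModuleCat.{u} R, gorensteinFlatDimension R M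

/-- `M` is strongly `n`-Gorenstein projective: there is a short exact sequence
`0 → M → P → M → 0` with `pd_R(P) ≤ n`, and `Ext^{n+1}_R(M, Q) = 0` for all projective `Q`. -/
def IsStronglyGorensteinProjective (n : ℕ) (M : ModuleCat.{u} R) : Prop :=
  (∃ (P : ModuleCat.{u} R) (f : M →ₗ[R] P) (g : P →ₗ[R] M),
    Function.Injective f ∧ Function.Exact f g ∧ Function.Surjective g ∧
      HasProjectiveDimensionLE P n) ∧
  ∀ Q : ModuleCat.{u} R, Module.Projective R Q → Subsingleton (Abelian.Ext.{u} M Q (n + 1))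

/-- `M` is strongly `n`-Gorenstein flat: there is a short exact sequence
`0 → M → F → M → 0` with `fd_R(F) ≤ n`, and `Tor_{n+1}^R(M, I) = 0` for all injective `I`. -/
def IsStronglyGorensteinFlat (n : ℕ) (M : ModuleCat.{u} R) : Prop :=
  (∃ (F : ModuleCat.{u} R) (f : M →ₗ[R] F) (g : F →ₗ[R] M),
    Function.Injective f ∧ Function.Exact f g ∧ Function.Surjective g ∧
      HasFlatDimensionLE R n F) ∧
  ∀ I : ModuleCat.{u} R, Module.Injective R I →
    Limits.IsZero (((Tor (ModuleCat.{u} R) (n + 1)).obj M).obj I)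

/-- `R` is an `n`-SG ring: every `R`-module is strongly `n`-Gorenstein projective. -/
def IsSG (n : ℕ) : Prop := ∀ M : ModuleCat.{u} R, IsStronglyGorensteinProjective R n M

/-- `R` is an `n`-wSG ring: every `R`-module is strongly `n`-Gorenstein flat. -/
def IsWSG (n : ℕ) : Prop := ∀ M : ModuleCat.{u} R, IsStronglyGorensteinFlat R n M

/-- `R` is quasi-Frobenius: Noetherian and injective as a module over itself. -/
def IsQuasiFrobenius : Prop := IsNoetherianRing R ∧ Module.Injective R R

/-- The truncated polynomial ring `K[X]/(X ^ m)`. -/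
abbrev TruncPoly (K : Type u) [Field K] (m : ℕ) : Type u :=
  Polynomial K ⧸ Ideal.span {(Polynomial.X : Polynomial K) ^ m}

end StronglyGorenstein

end

/-!
The rings in question arise from `K[X]/(X ^ m)` by products and polynomial extensions, and both
their Gorenstein dimensions and their failure to be `n`-SG come from elementary structure that
survives these two constructions.

*Upper bounds.* The ring `T = K[X]/(X ^ m)` is a Frobenius algebra over `B = K`: the coefficient of
`X ^ (m - 1)` is a linear form for which the monomials form dual bases (`FrobeniusSystem`). Then
`T × S` is a Frobenius extension of `K × S`, and `T[X₁, …, Xₙ]` of `K[X₁, …, Xₙ]`; these two base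
rings have global dimension at most `n`, the second one by Hilbert's syzygy theorem. Over a
Frobenius extension, inducing a `B`-module to `T` is the same as coinducing it. Hence a `T`-module
which is projective over `B` has `B`-split embeddings into, and `B`-split surjections from, a
projective `T`-module, and projective modules are relatively injective, injective modules relatively
flat (`exists_extension`, `rTensor_injective`). Splicing gives complete resolutions
(`isGorenstein_of_isProjectiveOver`), and as `n`-th syzygies over `T` are projective over `B`, both
Gorenstein dimensions are at most `n`. In the same way `Ext^(n+1)` into projective modules vanishes.
Injective `T`-modules are summands of induced ones, so they have projective dimension at most `n`,
which gives the vanishing of `Tor_(n+1)`.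

*Self extensions.* For `T = K[X]/(X ^ 2)` the kernel of `T ⊗[K] M → M` is `M` twisted by `X ↦ -X`.
The twist is isomorphic to `M`, by an involution of `M` which anticommutes with `X`
(`hasSelfExtension_of_sq_zero`). Over `T × S` one adds the split self extension on the `S`-part.

*Infinite weak dimension and failure of self extensions.* In `K[X]/(X ^ m)` the annihilators of
`a = X` and `b = X ^ (m - 1)` are generated by one another, and this stays so on modules of finite
flat dimension (`IsExactPairOn.of_hasFlatDimensionLE`), over products and over polynomial rings.
The quotient by `a` violates it when `a` divides `b`, so it has infinite flat dimension. Every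
extension of that quotient by itself violates it when `a ^ 2` divides `b`, which is the case for
`m = 3` and excludes the `n`-SG and the `n`-wSG property for all `n`.

*Lower bounds.* A Gorenstein projective or Gorenstein flat module `G` over `A[X₁, …, Xₙ]` has a
coresolution by flat modules, on which the variables form a weakly regular sequence. By Rees'
argument `Ext^i(A, G) = 0` for `i < n`, and a resolution of `A` by such modules of length less
than `n` would give `Hom(A, A) = 0` (`le_of_hasResolutionLE_quotient_X`). For `T × S`, base change
to `S` turns Gorenstein projective modules into arbitrarily high syzygies over `S`, hence into
projective ones, so that `Ggldim (T × S)` is at least `gldim S` (`le_Ggldim_of_gldim_eq`).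
-/

noncomputable section

namespace StronglyGorenstein

/-! ### Projective dimension in short exact sequences -/

section ProjectiveDimension

variable {A : Type u} [CommRing A]

theorem shortExact_mk {M₁ M₂ M₃ : Type u} [AddCommGroup M₁] [AddCommGroup M₂] [AddCommGroup M₃]
    [Module A M₁] [Module A M₂] [Module A M₃] {f : M₁ →ₗ[A] M₂} {g : M₂ →ₗ[A] M₃}
    (hf : Function.Injective f) (hfg : Function.Exact f g) (hg : Function.Surjective g) :
    (ShortComplex.mk (ModuleCat.ofHom f) (ModuleCat.ofHom g) (by
      ext x; exact hfg.apply_apply_eq_zero x)).ShortExact where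
  exact := (ShortComplex.ShortExact.moduleCat_exact_iff_function_exact _).2 hfg
  mono_f := (ModuleCat.mono_iff_injective _).2 hf
  epi_g := (ModuleCat.epi_iff_surjective _).2 hg

theorem exact_ker_subtype {M N : Type u} [AddCommGroup M] [AddCommGroup N] [Module A M]
    [Module A N] (p : M →ₗ[A] N) : Function.Exact (LinearMap.ker p).subtype p := by
  rw [LinearMap.exact_iff, Submodule.range_subtype]

variable {M₁ M₂ M₃ : Type u} [AddCommGroup M₁] [AddCommGroup M₂] [AddCommGroup M₃]
    [Module A M₁] [Module A M₂] [Module A M₃]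

theorem hasProjectiveDimensionLE_zero_iff (M : ModuleCat.{u} A) :
    HasProjectiveDimensionLE M 0 ↔ Module.Projective A M := by
  rw [← projective_iff_hasProjectiveDimensionLE_zero, IsProjective.iff_projective]

theorem hasProjectiveDimensionLE_left {f : M₁ →ₗ[A] M₂} {g : M₂ →ₗ[A] M₃}
    (hf : Function.Injective f) (hfg : Function.Exact f g) (hg : Function.Surjective g) (n : ℕ)
    (h₂ : HasProjectiveDimensionLE (ModuleCat.of A M₂) n)
    (h₃ : HasProjectiveDimensionLE (ModuleCat.of A M₃) (n + 1)) :
    HasProjectiveDimensionLE (ModuleCat.of A M₁) n :=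
  (shortExact_mk hf hfg hg).hasProjectiveDimensionLT_X₁ (n + 1) h₂ h₃

theorem hasProjectiveDimensionLE_middle {f : M₁ →ₗ[A] M₂} {g : M₂ →ₗ[A] M₃}
    (hf : Function.Injective f) (hfg : Function.Exact f g) (hg : Function.Surjective g) (n : ℕ)
    (h₁ : HasProjectiveDimensionLE (ModuleCat.of A M₁) n)
    (h₃ : HasProjectiveDimensionLE (ModuleCat.of A M₃) n) :
    HasProjectiveDimensionLE (ModuleCat.of A M₂) n :=
  (shortExact_mk hf hfg hg).hasProjectiveDimensionLT_X₂ (n + 1) h₁ h₃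

theorem hasProjectiveDimensionLE_right {f : M₁ →ₗ[A] M₂} {g : M₂ →ₗ[A] M₃}
    (hf : Function.Injective f) (hfg : Function.Exact f g) (hg : Function.Surjective g) (n : ℕ)
    (h₁ : HasProjectiveDimensionLE (ModuleCat.of A M₁) n)
    (h₂ : HasProjectiveDimensionLE (ModuleCat.of A M₂) (n + 1)) :
    HasProjectiveDimensionLE (ModuleCat.of A M₃) (n + 1) :=
  (shortExact_mk hf hfg hg).hasProjectiveDimensionLT_X₃ (n + 1) h₁ h₂

theorem hasProjectiveDimensionLE_of_le (M : ModuleCat.{u} A) {m n : ℕ} (h : m ≤ n)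
    (hM : HasProjectiveDimensionLE M m) : HasProjectiveDimensionLE M n :=
  hasProjectiveDimensionLT_of_ge M (m + 1) (n + 1) (by lia)

theorem hasProjectiveDimensionLE_of_projective [Module.Projective A M₁] (n : ℕ) :
    HasProjectiveDimensionLE (ModuleCat.of A M₁) n :=
  hasProjectiveDimensionLE_of_le _ (Nat.zero_le n)
    ((hasProjectiveDimensionLE_zero_iff (ModuleCat.of A M₁)).2 ‹_›)

theorem hasProjectiveDimensionLE_of_retract (s : M₁ →ₗ[A] M₂) (r : M₂ →ₗ[A] M₁)
    (h : r ∘ₗ s = LinearMap.id) (n : ℕ) (h₂ : HasProjectiveDimensionLE (ModuleCat.of A M₂) n) :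
    HasProjectiveDimensionLE (ModuleCat.of A M₁) n :=
  (Retract.mk (X := ModuleCat.of A M₁) (Y := ModuleCat.of A M₂) (ModuleCat.ofHom s)
    (ModuleCat.ofHom r) (by rw [← ModuleCat.ofHom_comp, h]; rfl)).hasProjectiveDimensionLT _

end ProjectiveDimension

/-! ### Resolutions by a class of modules -/

section Resolutions

variable {A : Type u} [CommRing A]

theorem HasResolutionLE.imp {C D : ModuleCat.{u} A → Prop} (hCD : ∀ M, C M → D M) :
    ∀ (n : ℕ) {M : ModuleCat.{u} A}, HasResolutionLE A C n M → HasResolutionLE A D n M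
  | 0, _, h => hCD _ h
  | n + 1, _, ⟨X, p, hX, hp, h⟩ => ⟨X, p, hCD X hX, hp, h.imp hCD n⟩

/-- Having projective dimension at most `n` in the sense of `Ext` is the same as having
a projective resolution of length `n`. -/
theorem hasResolutionLE_projective_iff (n : ℕ) (M : ModuleCat.{u} A) :
    HasResolutionLE A (fun P => Module.Projective A P) n M ↔ HasProjectiveDimensionLE M n := by
  induction n generalizing M with
  | zero => exact (hasProjectiveDimensionLE_zero_iff M).symm
  | succ n ih =>
    constructor
    · rintro ⟨X, p, hX, hp, h⟩
      exact hasProjectiveDimensionLE_right (Submodule.subtype_injective _) (exact_ker_subtype p) hp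
        n ((ih _).1 h) (have := hX; hasProjectiveDimensionLE_of_projective _)
    · intro h
      have hp : Function.Surjective (Finsupp.linearCombination A (id : M → M)) :=
        Finsupp.linearCombination_id_surjective A M
      refine ⟨ModuleCat.of A (M →₀ A), Finsupp.linearCombination A (id : M → M),
        (inferInstance : Module.Projective A (M →₀ A)), hp, (ih _).2 ?_⟩
      exact hasProjectiveDimensionLE_left (Submodule.subtype_injective _) (exact_ker_subtype _) hp
        n (hasProjectiveDimensionLE_of_projective _) h

end Resolutions

/-! ### Projective dimension under change of rings -/

section ChangeOfRings

open scoped TensorProduct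

variable {B T : Type u} [CommRing B] [CommRing T] [Algebra B T]

theorem projective_finsupp {ι : Type u} {P : Type u} [AddCommGroup P] [Module B P]
    [Module.Projective B P] : Module.Projective B (ι →₀ P) := by
  classical
  exact Module.Projective.of_equiv (finsuppLequivDFinsupp B (ι := ι) (M := P)).symm

theorem projective_restrict {M : Type u} [AddCommGroup M] [Module B M] [Module T M]
    [IsScalarTower B T M] [Module.Projective B T] [Module.Projective T M] :
    Module.Projective B M := by
  obtain ⟨s, hs⟩ := (Module.projective_def'.1 ‹Module.Projective T M›)
  have := projective_finsupp (B := B) (ι := M) (P := T)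
  exact Module.Projective.of_split (s.restrictScalars B)
    ((Finsupp.linearCombination T (id : M → M)).restrictScalars B)
    (LinearMap.ext fun x => DFunLike.congr_fun hs x)

/-- Restriction along a ring map `B → T` with `T` projective over `B` does not raise the
projective dimension. -/
theorem hasProjectiveDimensionLE_restrict [Module.Projective B T] (n : ℕ) (M : Type u)
    [AddCommGroup M] [Module B M] [Module T M] [IsScalarTower B T M]
    (h : HasProjectiveDimensionLE (ModuleCat.of T M) n) :
    HasProjectiveDimensionLE (ModuleCat.of B M) n := by
  induction n generalizing M with
  | zero =>
    have : Module.Projective T M := (hasProjectiveDimensionLE_zero_iff (ModuleCat.of T M)).1 h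
    exact (hasProjectiveDimensionLE_zero_iff (ModuleCat.of B M)).2 (projective_restrict (T := T))
  | succ n ih =>
    let p : (M →₀ T) →ₗ[T] M := Finsupp.linearCombination T id
    have hp : Function.Surjective p := Finsupp.linearCombination_id_surjective T M
    have hK := ih _ (hasProjectiveDimensionLE_left (Submodule.subtype_injective _)
      (exact_ker_subtype p) hp n (hasProjectiveDimensionLE_of_projective _) h)
    have := projective_finsupp (B := B) (ι := M) (P := T)
    exact hasProjectiveDimensionLE_right (f := (LinearMap.ker p).subtype.restrictScalars B)
      (g := p.restrictScalars B) (Submodule.subtype_injective _) (exact_ker_subtype p) hp n hK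
      (hasProjectiveDimensionLE_of_projective _)

/-- A class `C` of `B`-modules which base change along a flat map `B → T` makes projective
gives, from a `C`-resolution, a projective resolution of the base change. -/
theorem hasProjectiveDimensionLE_baseChange_of_hasResolutionLE [Module.Flat B T]
    {C : ModuleCat.{u} B → Prop} (hC : ∀ X : ModuleCat.{u} B, C X → Module.Projective T (T ⊗[B] X))
    (n : ℕ) (N : ModuleCat.{u} B) (h : HasResolutionLE B C n N) :
    HasProjectiveDimensionLE (ModuleCat.of T (T ⊗[B] N)) n := by
  induction n generalizing N with
  | zero => exact (hasProjectiveDimensionLE_zero_iff (ModuleCat.of T (T ⊗[B] N))).2 (hC N h)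
  | succ n ih =>
    obtain ⟨X, p, hX, hp, h⟩ := h
    have := hC X hX
    exact hasProjectiveDimensionLE_right (f := (LinearMap.ker p).subtype.baseChange T)
      (g := p.baseChange T)
      (Module.Flat.lTensor_preserves_injective_linearMap (M := T) _
        (Submodule.subtype_injective _))
      (lTensor_exact T (exact_ker_subtype p) hp) (LinearMap.lTensor_surjective T hp) n (ih _ h)
      (hasProjectiveDimensionLE_of_projective _)

theorem hasProjectiveDimensionLE_baseChange [Module.Flat B T] (n : ℕ) (N : Type u)
    [AddCommGroup N] [Module B N] (h : HasProjectiveDimensionLE (ModuleCat.of B N) n) :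
    HasProjectiveDimensionLE (ModuleCat.of T (T ⊗[B] N)) n :=
  hasProjectiveDimensionLE_baseChange_of_hasResolutionLE
    (fun X (_ : Module.Projective B X) => (inferInstance : Module.Projective T (T ⊗[B] X))) n
    (ModuleCat.of B N) ((hasResolutionLE_projective_iff n _).2 h)

/-- A module over a quotient ring is its own base change to that ring. -/
def baseChangeEquivOfSurjective (hs : Function.Surjective (algebraMap B T)) (N : Type u)
    [AddCommGroup N] [Module B N] [Module T N] [IsScalarTower B T N] : (T ⊗[B] N) ≃ₗ[T] N :=
  LinearEquiv.ofBijective (LinearMap.liftBaseChange T (LinearMap.id : N →ₗ[B] N)) <| by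
    have key : ∀ z : T ⊗[B] N,
        (1 : T) ⊗ₜ[B] (LinearMap.liftBaseChange T (LinearMap.id : N →ₗ[B] N) z) = z := by
      intro z
      induction z with
      | zero => simp
      | add x y hx hy => rw [map_add, TensorProduct.tmul_add, hx, hy]
      | tmul s n =>
        obtain ⟨b, rfl⟩ := hs s
        simp only [LinearMap.liftBaseChange_tmul, LinearMap.id_apply, algebraMap_smul]
        rw [← TensorProduct.smul_tmul, Algebra.smul_def, mul_one]
    exact ⟨fun x y h => by rw [← key x, h, key y],
      fun n => ⟨1 ⊗ₜ n, by simp⟩⟩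

end ChangeOfRings

/-! ### Modules over a product of two rings -/

section Products

open scoped TensorProduct

variable {T A S : Type u} [CommRing T] [CommRing A] [CommRing S] [Algebra T A] [Algebra T S]

/-- The algebra maps `T → A` and `T → S` exhibit `T` as the product ring `A × S`. -/
def IsProductDecomposition (T A S : Type u) [CommRing T] [CommRing A] [CommRing S] [Algebra T A]
    [Algebra T S] : Prop :=
  Function.Bijective (fun t : T => (algebraMap T A t, algebraMap T S t))

variable (h : IsProductDecomposition T A S)
include h

/-- The isomorphism of `T`-modules underlying a product decomposition. -/
def IsProductDecomposition.linearEquiv : T ≃ₗ[T] A × S :=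
  LinearEquiv.ofBijective ((Algebra.linearMap T A).prod (Algebra.linearMap T S)) h

theorem IsProductDecomposition.projective_left : Module.Projective T A :=
  have := Module.Projective.of_equiv h.linearEquiv
  Module.Projective.of_split (LinearMap.inl T A S) (LinearMap.fst T A S) (LinearMap.fst_comp_inl ..)

theorem IsProductDecomposition.projective_right : Module.Projective T S :=
  have := Module.Projective.of_equiv h.linearEquiv
  Module.Projective.of_split (LinearMap.inr T A S) (LinearMap.snd T A S) (LinearMap.snd_comp_inr ..)

theorem IsProductDecomposition.surjective_right : Function.Surjective (algebraMap T S) :=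
  fun s => let ⟨t, ht⟩ := h.2 (0, s); ⟨t, congrArg Prod.snd ht⟩

/-- Over `T = A × S`, every module is the product of an `A`-module and an `S`-module. -/
def IsProductDecomposition.moduleEquiv (M : Type u) [AddCommGroup M] [Module T M] :
    M ≃ₗ[T] (A ⊗[T] M) × (S ⊗[T] M) :=
  (TensorProduct.lid T M).symm ≪≫ₗ TensorProduct.congr h.linearEquiv (LinearEquiv.refl T M) ≪≫ₗ
    TensorProduct.prodLeft T T A S M

/-- A bound for the projective dimensions over both factors is one over the product. -/
theorem IsProductDecomposition.hasProjectiveDimensionLE {n : ℕ}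
    (hA : ∀ M : ModuleCat.{u} A, HasProjectiveDimensionLE M n)
    (hS : ∀ M : ModuleCat.{u} S, HasProjectiveDimensionLE M n) (M : ModuleCat.{u} T) :
    HasProjectiveDimensionLE M n := by
  have := h.projective_left
  have := h.projective_right
  have h₁ := hasProjectiveDimensionLE_restrict (B := T) n _ (hA (ModuleCat.of A (A ⊗[T] M)))
  have h₂ := hasProjectiveDimensionLE_restrict (B := T) n _ (hS (ModuleCat.of S (S ⊗[T] M)))
  have h₃ := hasProjectiveDimensionLE_middle (f := LinearMap.inl T (A ⊗[T] M) (S ⊗[T] M))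
    (g := LinearMap.snd T (A ⊗[T] M) (S ⊗[T] M)) LinearMap.inl_injective
    (Function.Exact.inl_snd) LinearMap.snd_surjective n h₁ h₂
  exact hasProjectiveDimensionLE_of_retract (M₁ := M) (h.moduleEquiv M).toLinearMap
    (h.moduleEquiv M).symm.toLinearMap (by simp) n h₃

end Products

/-! ### Hilbert's syzygy theorem -/

section PolynomialRings

open scoped TensorProduct Polynomial

theorem tensor_polynomial_ext {A : Type u} [CommRing A] {M N : Type u} [AddCommGroup M]
    [Module A M] [AddCommGroup N] [Module A N]
    {f g : A[X] ⊗[A] M →ₗ[A] N}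
    (h : ∀ (k : ℕ) (m : M), f ((Polynomial.X ^ k : A[X]) ⊗ₜ m) = g ((Polynomial.X ^ k) ⊗ₜ m)) :
    f = g := by
  refine TensorProduct.ext ((Polynomial.basisMonomials A).ext fun k => LinearMap.ext fun m => ?_)
  simpa [← Polynomial.X_pow_eq_monomial] using h k m

variable {A : Type u} [CommRing A] {M : Type u} [AddCommGroup M] [Module A M] [Module A[X] M]
  [IsScalarTower A A[X] M]

variable (A M) in
/-- The map `X ⊗ 1 - 1 ⊗ X` on `A[X] ⊗ M`, for an `A[X]`-module `M`. -/
def polynomialDiff : A[X] ⊗[A] M →ₗ[A[X]] A[X] ⊗[A] M :=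
  LinearMap.lsmul A[X] (A[X] ⊗[A] M) Polynomial.X -
    ((LinearMap.lsmul A[X] M Polynomial.X).restrictScalars A).baseChange A[X]

theorem polynomialDiff_tmul (p : A[X]) (m : M) :
    polynomialDiff A M (p ⊗ₜ m) =
      (Polynomial.X * p) ⊗ₜ m - p ⊗ₜ[A] ((Polynomial.X : A[X]) • m) := by
  simp [polynomialDiff, TensorProduct.smul_tmul']

variable (A M) in
/-- The coefficient map `m ↦ ∑ i < k, X ^ i ⊗ X ^ (k - 1 - i) m` of the divided difference,
defined by recursion on `k`. -/
def dividedDifferenceAux : ℕ → M →ₗ[A] A[X] ⊗[A] M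
  | 0 => 0
  | k + 1 => TensorProduct.mk A A[X] M (Polynomial.X ^ k) +
      dividedDifferenceAux k ∘ₗ (LinearMap.lsmul A[X] M Polynomial.X).restrictScalars A

variable (A M) in
/-- The `A`-linear divided difference `(p ⊗ 1 - 1 ⊗ p) / (X ⊗ 1 - 1 ⊗ X)`, acting on `M` through
the second factor. -/
def dividedDifference : A[X] ⊗[A] M →ₗ[A] A[X] ⊗[A] M :=
  TensorProduct.lift ((Polynomial.basisMonomials A).constr A (dividedDifferenceAux A M))

theorem dividedDifference_X_pow (k : ℕ) (m : M) :
    dividedDifference A M ((Polynomial.X ^ k : A[X]) ⊗ₜ m) = dividedDifferenceAux A M k m := by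
  have := (Polynomial.basisMonomials A).constr_basis A (dividedDifferenceAux A M) k
  rw [Polynomial.coe_basisMonomials] at this
  rw [Polynomial.X_pow_eq_monomial, dividedDifference, TensorProduct.lift.tmul, this]

theorem dividedDifference_polynomialDiff (z : A[X] ⊗[A] M) :
    dividedDifference A M (polynomialDiff A M z) = z := by
  have : dividedDifference A M ∘ₗ (polynomialDiff A M).restrictScalars A = LinearMap.id := by
    refine tensor_polynomial_ext fun k m => ?_
    simp only [LinearMap.comp_apply, LinearMap.restrictScalars_apply, polynomialDiff_tmul, map_sub,
      ← pow_succ', dividedDifference_X_pow, LinearMap.id_apply]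
    simp [dividedDifferenceAux]
  exact DFunLike.congr_fun this z

theorem polynomialDiff_dividedDifference (z : A[X] ⊗[A] M) :
    polynomialDiff A M (dividedDifference A M z) =
      z - 1 ⊗ₜ LinearMap.liftBaseChange A[X] (LinearMap.id : M →ₗ[A] M) z := by
  have : (polynomialDiff A M).restrictScalars A ∘ₗ dividedDifference A M = LinearMap.id -
      TensorProduct.mk A A[X] M 1 ∘ₗ
        (LinearMap.liftBaseChange A[X] (LinearMap.id : M →ₗ[A] M)).restrictScalars A := by
    refine tensor_polynomial_ext fun k m => ?_
    simp only [LinearMap.comp_apply, LinearMap.restrictScalars_apply, dividedDifference_X_pow,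
      LinearMap.sub_apply, LinearMap.id_apply, TensorProduct.mk_apply,
      LinearMap.liftBaseChange_tmul]
    induction k generalizing m with
    | zero => simp [dividedDifferenceAux]
    | succ k ih =>
      simp only [dividedDifferenceAux, LinearMap.add_apply, map_add, LinearMap.comp_apply,
        TensorProduct.mk_apply, polynomialDiff_tmul, LinearMap.restrictScalars_apply,
        LinearMap.lsmul_apply, ih, smul_smul, ← pow_succ, ← pow_succ']
      abel
  exact DFunLike.congr_fun this z

/-- Hilbert's syzygy theorem for one variable: `0 → A[X] ⊗ M → A[X] ⊗ M → M → 0` is exact, its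
first map being multiplication by `X ⊗ 1 - 1 ⊗ X`. -/
theorem hasProjectiveDimensionLE_polynomial {n : ℕ}
    (hA : ∀ M : ModuleCat.{u} A, HasProjectiveDimensionLE M n) (M : ModuleCat.{u} A[X]) :
    HasProjectiveDimensionLE M (n + 1) := by
  let _ : Module A M := Module.compHom M (algebraMap A A[X])
  have : IsScalarTower A A[X] M := ⟨fun a p m => by
    rw [Algebra.smul_def, mul_smul]; rfl⟩
  have hpd := hasProjectiveDimensionLE_baseChange (T := A[X]) n M (hA (ModuleCat.of A M))
  refine hasProjectiveDimensionLE_right (f := polynomialDiff A M)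
    (g := LinearMap.liftBaseChange A[X] (LinearMap.id : M →ₗ[A] M))
    (Function.LeftInverse.injective dividedDifference_polynomialDiff) (fun z => ⟨fun hz => ?_, ?_⟩)
    (fun m => ⟨1 ⊗ₜ m, by simp⟩) n hpd (hasProjectiveDimensionLE_of_le _ n.le_succ hpd)
  · exact ⟨dividedDifference A M z, by rw [polynomialDiff_dividedDifference, hz]; simp⟩
  · rintro ⟨w, rfl⟩
    induction w with
    | zero => simp
    | add x y hx hy => rw [map_add, map_add, hx, hy, add_zero]
    | tmul p m =>
      rw [polynomialDiff_tmul]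
      simp [mul_comm Polynomial.X p, mul_smul]

theorem hasProjectiveDimensionLE_of_ringEquiv {R R' : Type u} [CommRing R] [CommRing R']
    (e : R ≃+* R') {n : ℕ} (hR : ∀ M : ModuleCat.{u} R, HasProjectiveDimensionLE M n)
    (M : ModuleCat.{u} R') : HasProjectiveDimensionLE M n := by
  let _ : Algebra R R' := e.toRingHom.toAlgebra
  let _ : Algebra R' R := e.symm.toRingHom.toAlgebra
  let _ : Module R M := Module.compHom M e.toRingHom
  have : IsScalarTower R' R M := ⟨fun a r m => by
    change e (e.symm a * r) • m = a • e r • m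
    rw [map_mul, e.apply_symm_apply, mul_smul]⟩
  let eR : R' ≃ₗ[R'] R :=
    { e.symm with map_smul' := fun a b => (map_mul e.symm a b :) }
  have : Module.Projective R' R := Module.Projective.of_equiv eR
  exact hasProjectiveDimensionLE_restrict (B := R') (T := R) n M (hR (ModuleCat.of R M))

/-- Hilbert's syzygy theorem. -/
theorem hasProjectiveDimensionLE_mvPolynomial (K : Type u) [Field K] (n : ℕ) :
    ∀ M : ModuleCat.{u} (MvPolynomial (Fin n) K), HasProjectiveDimensionLE M n := by
  induction n with
  | zero =>
    refine hasProjectiveDimensionLE_of_ringEquiv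
      (MvPolynomial.isEmptyRingEquiv K (Fin 0)).symm fun M => ?_
    exact hasProjectiveDimensionLE_of_projective (M₁ := M) 0
  | succ n ih =>
    exact hasProjectiveDimensionLE_of_ringEquiv
      (MvPolynomial.finSuccEquiv K n).symm.toRingEquiv (hasProjectiveDimensionLE_polynomial ih)

end PolynomialRings

/-! ### Exact pairs of elements -/

section ExactPairs

variable {T : Type u} [CommRing T]

/-- The elements `a` and `b` form an exact pair on `M`: on `M`, the kernel of each is the image
of the other. -/
def IsExactPairOn (a b : T) (M : Type u) [AddCommGroup M] [Module T M] : Prop :=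
  Function.Exact (fun m : M => b • m) (fun m : M => a • m) ∧
    Function.Exact (fun m : M => a • m) (fun m : M => b • m)

variable {a b : T}

/-- Exactness of multiplication by `b`, then by `a`, passes from `T` to flat modules: by the
equational criterion, a relation `a m = 0` comes from relations `a c = 0` in `T`. -/
theorem exact_smul_of_flat (h : Function.Exact (fun t : T => b • t) (fun t : T => a • t))
    (M : Type u) [AddCommGroup M] [Module T M] [Module.Flat T M] :
    Function.Exact (fun m : M => b • m) (fun m : M => a • m) := by
  intro m
  constructor
  · intro hm
    obtain ⟨k, c, y, hy, hc⟩ := Module.Flat.isTrivialRelation_of_sum_smul_eq_zero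
      (ι := Fin 1) (f := fun _ => a) (x := fun _ => m) (by simpa using hm)
    have hdiv : ∀ j, ∃ d : T, b • d = c 0 j := fun j =>
      (h _).1 (by simpa using hc j)
    choose d hd using hdiv
    refine ⟨∑ j, d j • y j, ?_⟩
    simp only [Finset.smul_sum, ← smul_assoc, hd]
    exact (hy 0).symm
  · rintro ⟨m', rfl⟩
    have : a • b • (1 : T) = 0 := (h _).2 ⟨1, rfl⟩
    simp only [smul_eq_mul, mul_one] at this
    simp [smul_smul, this]

theorem IsExactPairOn.of_flat (h : IsExactPairOn a b T) (M : Type u) [AddCommGroup M] [Module T M]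
    [Module.Flat T M] : IsExactPairOn a b M :=
  ⟨exact_smul_of_flat h.1 M, exact_smul_of_flat h.2 M⟩

theorem exact_smul_of_shortExact {L F M : Type u} [AddCommGroup L] [AddCommGroup F]
    [AddCommGroup M] [Module T L] [Module T F] [Module T M] {f : L →ₗ[T] F} {g : F →ₗ[T] M}
    (hf : Function.Injective f) (hfg : Function.Exact f g) (hg : Function.Surjective g)
    (hL : Function.Exact (fun m : L => a • m) (fun m : L => b • m))
    (hF : Function.Exact (fun m : F => b • m) (fun m : F => a • m)) :
    Function.Exact (fun m : M => b • m) (fun m : M => a • m) := by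
  intro m
  constructor
  · intro hm
    obtain ⟨x, rfl⟩ := hg m
    obtain ⟨l, hl⟩ := (hfg (a • x)).1 (by simpa using hm)
    -- since `b a = 0` on `F`, the element `l` lies in the kernel of `b`
    have hba : b • a • x = 0 := by
      rw [smul_comm]
      exact (hF _).2 ⟨x, rfl⟩
    obtain ⟨l', rfl⟩ := (hL l).1 (hf (by simp [hl, hba]))
    obtain ⟨y, hy⟩ := (hF (x - f l')).1 (by simp [smul_sub, ← hl])
    refine ⟨g y, ?_⟩
    simp only at hy ⊢
    rw [← map_smul, hy, map_sub, hfg.apply_apply_eq_zero, sub_zero]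
  · rintro ⟨m', rfl⟩
    obtain ⟨x, rfl⟩ := hg m'
    have : a • b • x = 0 := (hF _).2 ⟨x, rfl⟩
    simp only
    rw [← map_smul, ← map_smul, this, map_zero]

/-- An exact pair on `T` is one on every module of finite flat dimension: a complex of period two
which is exact on the first two terms of a short exact sequence is exact on the third. -/
theorem IsExactPairOn.of_hasFlatDimensionLE (h : IsExactPairOn a b T) (n : ℕ) (M : ModuleCat.{u} T)
    (hM : HasFlatDimensionLE T n M) : IsExactPairOn a b M := by
  induction n generalizing M with
  | zero =>
    have : Module.Flat T M := hM
    exact h.of_flat M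
  | succ n ih =>
    obtain ⟨X, p, hX, hp, hK⟩ := hM
    have : Module.Flat T X := hX
    have hX' := h.of_flat X
    have hK' := ih _ hK
    exact ⟨exact_smul_of_shortExact (Submodule.subtype_injective _) (exact_ker_subtype p) hp
        hK'.2 hX'.1,
      exact_smul_of_shortExact (Submodule.subtype_injective _) (exact_ker_subtype p) hp
        hK'.1 hX'.2⟩

theorem hasFlatDimensionLE_of_hasProjectiveDimensionLE {n : ℕ} {M : ModuleCat.{u} T}
    (h : HasProjectiveDimensionLE M n) : HasFlatDimensionLE T n M :=
  ((hasResolutionLE_projective_iff n M).2 h).imp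
    (fun _ h => have : Module.Projective T _ := h; (inferInstance : Module.Flat T _)) n

theorem smul_quotient_span_singleton (a : T) (m : T ⧸ Ideal.span {a}) : a • m = 0 := by
  obtain ⟨t, rfl⟩ := Ideal.Quotient.mk_surjective m
  rw [Algebra.smul_def, Ideal.Quotient.algebraMap_eq, ← map_mul, Ideal.Quotient.eq_zero_iff_mem]
  exact Ideal.mul_mem_right _ _ (Ideal.mem_span_singleton_self a)

theorem one_quotient_span_singleton_ne_zero (ha : ¬ IsUnit a) : (1 : T ⧸ Ideal.span {a}) ≠ 0 := by
  rw [← Ideal.span_singleton_eq_top, ← ne_eq, ← Ideal.Quotient.nontrivial_iff] at ha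
  exact one_ne_zero

/-- If `b` is a multiple of `a`, then `T / a` has infinite flat dimension: it is killed by `a`
and by `b`, so that the pair is not exact on it. -/
theorem wdim_eq_top_of_isExactPairOn (h : IsExactPairOn a b T) (hab : a ∣ b) (ha : ¬ IsUnit a) :
    wdim T = ⊤ := by
  have key : flatDimension T (ModuleCat.of T (T ⧸ Ideal.span {a})) = ⊤ := by
    simp only [flatDimension, resolutionDim, iInf_eq_top]
    intro n hn
    obtain ⟨c, rfl⟩ := hab
    obtain ⟨m, hm⟩ := ((h.of_hasFlatDimensionLE n _ hn).1 (1 : T ⧸ Ideal.span {a})).1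
      (smul_quotient_span_singleton a _)
    refine absurd hm.symm ?_
    simp only [mul_smul]
    rw [smul_quotient_span_singleton a (c • m)]
    exact one_quotient_span_singleton_ne_zero ha
  exact top_le_iff.1 (key ▸ le_iSup (flatDimension T) (ModuleCat.of T (T ⧸ Ideal.span {a})))

/-- If `b` is a multiple of `a ^ 2`, then no extension of `T / a` by itself has finite flat
dimension: such an extension is killed by `a ^ 2`, hence by `b`, and exactness of the pair would
make `a` act injectively on it. -/
theorem not_hasFlatDimensionLE_of_self_extension (h : IsExactPairOn a b T) (hab : a ^ 2 ∣ b)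
    (ha : ¬ IsUnit a) (n : ℕ) {F : ModuleCat.{u} T} {f : (T ⧸ Ideal.span {a}) →ₗ[T] F}
    {g : F →ₗ[T] (T ⧸ Ideal.span {a})} (hf : Function.Injective f) (hfg : Function.Exact f g) :
    ¬ HasFlatDimensionLE T n F := by
  intro hF
  obtain ⟨c, rfl⟩ := hab
  obtain ⟨x, hx⟩ := ((h.of_hasFlatDimensionLE n _ hF).1 (f 1)).1 (by
    simp only
    rw [← map_smul, smul_quotient_span_singleton, map_zero])
  obtain ⟨m, hm⟩ := (hfg (a • x)).1 (by rw [map_smul, smul_quotient_span_singleton])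
  have hkill : a ^ 2 • x = 0 := by
    rw [pow_two, mul_smul, ← hm, ← map_smul, smul_quotient_span_singleton, map_zero]
  refine one_quotient_span_singleton_ne_zero ha (hf ?_)
  rw [map_zero, ← hx]
  simp only
  rw [mul_comm, mul_smul, hkill, smul_zero]

theorem not_isWSG_of_isExactPairOn (h : IsExactPairOn a b T) (hab : a ^ 2 ∣ b) (ha : ¬ IsUnit a)
    (n : ℕ) : ¬ IsWSG T n := fun H =>
  let ⟨⟨_, _, _, hf, hfg, _, hF⟩, _⟩ := H (ModuleCat.of T (T ⧸ Ideal.span {a}))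
  not_hasFlatDimensionLE_of_self_extension h hab ha n hf hfg hF

theorem not_isSG_of_isExactPairOn (h : IsExactPairOn a b T) (hab : a ^ 2 ∣ b) (ha : ¬ IsUnit a)
    (n : ℕ) : ¬ IsSG T n := fun H =>
  let ⟨⟨_, _, _, hf, hfg, _, hF⟩, _⟩ := H (ModuleCat.of T (T ⧸ Ideal.span {a}))
  not_hasFlatDimensionLE_of_self_extension h hab ha n hf hfg
    (hasFlatDimensionLE_of_hasProjectiveDimensionLE hF)

/-- Over a product, an exact pair of the first factor is completed by `1` and `0`. -/
theorem IsExactPairOn.prod (h : IsExactPairOn a b T) (S : Type u) [CommRing S] :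
    IsExactPairOn ((a, 1) : T × S) (b, 0) (T × S) := by
  constructor
  · rintro ⟨x, y⟩
    have := h.1 x
    simp only [smul_eq_mul, Prod.mk_mul_mk, one_mul, Prod.mk_eq_zero, Set.mem_range] at this ⊢
    constructor
    · rintro ⟨hx, rfl⟩
      obtain ⟨z, rfl⟩ := this.1 hx
      exact ⟨(z, 0), by simp⟩
    · rintro ⟨⟨z, w⟩, hz⟩
      simp only [Prod.mk_mul_mk, zero_mul, Prod.mk.injEq] at hz
      exact ⟨this.2 ⟨z, hz.1⟩, hz.2.symm⟩
  · rintro ⟨x, y⟩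
    have := h.2 x
    simp only [smul_eq_mul, Prod.mk_mul_mk, zero_mul, Prod.mk_eq_zero, Set.mem_range,
      and_true] at this ⊢
    rw [this]
    constructor
    · rintro ⟨z, rfl⟩
      exact ⟨(z, y), by simp⟩
    · rintro ⟨⟨z, w⟩, hz⟩
      simp only [Prod.mk_mul_mk, Prod.mk.injEq] at hz
      exact ⟨z, hz.1⟩

theorem exact_smul_mvPolynomial (σ : Type)
    (h : Function.Exact (fun t : T => b • t) (fun t : T => a • t)) :
    Function.Exact (fun p : MvPolynomial σ T => (MvPolynomial.C b : MvPolynomial σ T) • p)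
      (fun p => (MvPolynomial.C a : MvPolynomial σ T) • p) := by
  intro p
  have h' : ∀ t, a * t = 0 ↔ b ∣ t := fun t =>
    (h t).trans ⟨fun ⟨s, hs⟩ => ⟨s, hs.symm⟩, fun ⟨s, hs⟩ => ⟨s, hs.symm⟩⟩
  have : (∃ q, MvPolynomial.C b * q = p) ↔ MvPolynomial.C b ∣ p :=
    ⟨fun ⟨s, hs⟩ => ⟨s, hs.symm⟩, fun ⟨s, hs⟩ => ⟨s, hs.symm⟩⟩
  simp only [smul_eq_mul, Set.mem_range]
  rw [this, MvPolynomial.C_dvd_iff_dvd_coeff, MvPolynomial.ext_iff]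
  simp only [← h', MvPolynomial.coeff_C_mul, MvPolynomial.coeff_zero]

theorem IsExactPairOn.mvPolynomial (h : IsExactPairOn a b T) (σ : Type) :
    IsExactPairOn (MvPolynomial.C a : MvPolynomial σ T) (MvPolynomial.C b) (MvPolynomial σ T) :=
  ⟨exact_smul_mvPolynomial σ h.1, exact_smul_mvPolynomial σ h.2⟩

end ExactPairs

/-! ### Truncated polynomial rings -/

section TruncatedPolynomials

variable (K : Type u) [Field K] (m : ℕ)

/-- The class of `X` in `K[X]/(X ^ m)`. -/
def truncX : TruncPoly K m := Ideal.Quotient.mk _ Polynomial.X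

variable {K m}

theorem mk_eq_zero_iff_coeff {p : Polynomial K} :
    (Ideal.Quotient.mk (Ideal.span {(Polynomial.X : Polynomial K) ^ m}) p) = 0 ↔
      ∀ i < m, p.coeff i = 0 := by
  rw [Ideal.Quotient.eq_zero_iff_mem, Ideal.mem_span_singleton, Polynomial.X_pow_dvd_iff]

theorem exact_smul_truncX {i j : ℕ} (hij : i + j = m) :
    Function.Exact (fun t : TruncPoly K m => truncX K m ^ j • t)
      (fun t => truncX K m ^ i • t) := by
  intro t
  obtain ⟨p, rfl⟩ := Ideal.Quotient.mk_surjective t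
  simp only [truncX, smul_eq_mul, ← map_pow, ← map_mul]
  constructor
  · intro h
    rw [Ideal.Quotient.eq_zero_iff_mem, Ideal.mem_span_singleton, ← hij, pow_add] at h
    obtain ⟨q, rfl⟩ := (mul_dvd_mul_iff_left (pow_ne_zero i Polynomial.X_ne_zero)).1 h
    exact ⟨Ideal.Quotient.mk _ q, by simp⟩
  · rintro ⟨s, hs⟩
    obtain ⟨q, rfl⟩ := Ideal.Quotient.mk_surjective s
    simp only at hs
    rw [map_mul, ← hs, ← map_mul, ← map_mul, ← mul_assoc, ← pow_add, hij,
      Ideal.Quotient.eq_zero_iff_mem]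
    exact Ideal.mul_mem_right _ _ (Ideal.mem_span_singleton_self _)

theorem isExactPairOn_truncX (i : ℕ) :
    IsExactPairOn (truncX K (i + 1)) (truncX K (i + 1) ^ i) (TruncPoly K (i + 1)) := by
  have h₁ := exact_smul_truncX (K := K) (add_comm 1 i)
  have h₂ := exact_smul_truncX (K := K) (rfl : i + 1 = i + 1)
  rw [pow_one] at h₁ h₂
  exact ⟨h₁, h₂⟩

theorem not_isUnit_truncX (hm : m ≠ 0) : ¬ IsUnit (truncX K m) := by
  intro h
  have h0 : truncX K m ^ m = 0 := by
    rw [truncX, ← map_pow, Ideal.Quotient.eq_zero_iff_mem]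
    exact Ideal.mem_span_singleton_self _
  have h1 : (1 : TruncPoly K m) = 0 := by
    have := (h.pow m).mul_left_cancel (b := 1) (c := 0) (by rw [h0]; simp)
    exact this
  rw [← map_one (Ideal.Quotient.mk _), mk_eq_zero_iff_coeff] at h1
  simpa using h1 0 (Nat.pos_of_ne_zero hm)

end TruncatedPolynomials

/-! ### Frobenius extensions -/

section Frobenius

open scoped TensorProduct

/-- A Frobenius system for an algebra `T` over `B`: a `B`-linear form on `T` together with finite
families `x` and `y` which are dual to each other for the pairing `(a, b) ↦ form (a * b)`. -/
structure FrobeniusSystem (B T : Type u) [CommRing B] [CommRing T] [Algebra B T] where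
  /-- The index type of the dual families. -/
  ι : Type
  [fintype : Fintype ι]
  /-- The Frobenius form. -/
  form : T →ₗ[B] B
  /-- The first of the dual families. -/
  x : ι → T
  /-- The second of the dual families. -/
  y : ι → T
  sum_form_mul_x (a : T) : ∑ i, form (a * x i) • y i = a
  sum_form_mul_y (a : T) : ∑ i, form (a * y i) • x i = a

attribute [instance] FrobeniusSystem.fintype

namespace FrobeniusSystem

variable {B T : Type u} [CommRing B] [CommRing T] [Algebra B T] (Φ : FrobeniusSystem B T)
include Φ

/-- The maps `a ↦ (form (a * x i))ᵢ` and `(cᵢ)ᵢ ↦ ∑ cᵢ y i` make `T` a direct summand of a free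
module. -/
theorem projective : Module.Projective B T := by
  refine Module.Projective.of_split (M := Φ.ι → B)
    (LinearMap.pi fun i => Φ.form ∘ₗ LinearMap.mulRight B (Φ.x i))
    (∑ i, (LinearMap.toSpanSingleton B T (Φ.y i)) ∘ₗ LinearMap.proj i) ?_
  ext a
  simpa using Φ.sum_form_mul_x a

/-- The element `∑ x i ⊗ y i` is central in `T ⊗ T`. -/
theorem casimir {N : Type u} [AddCommGroup N] [Module B N] (β : T →ₗ[B] T →ₗ[B] N) (t : T) :
    ∑ i, β (t * Φ.x i) (Φ.y i) = ∑ i, β (Φ.x i) (t * Φ.y i) := by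
  have h₁ : ∀ i, β (Φ.x i) (t * Φ.y i) =
      ∑ j, Φ.form (t * Φ.y i * Φ.x j) • β (Φ.x i) (Φ.y j) := by
    intro i
    conv_lhs => rw [← Φ.sum_form_mul_x (t * Φ.y i)]
    simp
  have h₂ : ∀ j, β (t * Φ.x j) (Φ.y j) =
      ∑ i, Φ.form (t * Φ.y i * Φ.x j) • β (Φ.x i) (Φ.y j) := by
    intro j
    conv_lhs => rw [← Φ.sum_form_mul_y (t * Φ.x j)]
    simp [mul_right_comm]
  simp_rw [h₁, h₂]
  exact Finset.sum_comm

section Modules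

variable {M P N : Type u} [AddCommGroup M] [AddCommGroup P] [AddCommGroup N] [Module B M]
  [Module T M] [IsScalarTower B T M] [Module B P] [Module T P] [IsScalarTower B T P] [Module B N]

/-- The `T`-linear map `M → T ⊗[B] N` corresponding to a `B`-linear map `M → N`: over a Frobenius
extension, induced modules are coinduced. -/
def coinduce (φ : M →ₗ[B] N) : M →ₗ[T] T ⊗[B] N where
  toFun m := ∑ i, Φ.x i ⊗ₜ φ (Φ.y i • m)
  map_add' m m' := by simp [TensorProduct.tmul_add, Finset.sum_add_distrib]
  map_smul' t m := by
    have := Φ.casimir ((TensorProduct.mk B T N).compl₂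
      (φ ∘ₗ (LinearMap.toSpanSingleton T M m).restrictScalars B)) t
    simp only [LinearMap.compl₂_apply, TensorProduct.mk_apply, LinearMap.comp_apply,
      LinearMap.restrictScalars_apply, LinearMap.toSpanSingleton_apply] at this
    simp only [RingHom.id_apply, Finset.smul_sum, TensorProduct.smul_tmul', smul_eq_mul,
      smul_smul, this]
    simp only [mul_comm]

theorem coinduce_apply (φ : M →ₗ[B] N) (m : M) :
    Φ.coinduce φ m = ∑ i, Φ.x i ⊗ₜ φ (Φ.y i • m) := rfl

/-- The `B`-linear map `form ⊗ 1 : T ⊗[B] N → N`. -/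
def counit (N : Type u) [AddCommGroup N] [Module B N] : T ⊗[B] N →ₗ[B] N :=
  (TensorProduct.lid B N).toLinearMap ∘ₗ Φ.form.rTensor N

theorem counit_tmul (t : T) (n : N) : Φ.counit N (t ⊗ₜ n) = Φ.form t • n := by
  simp [counit]

/-- An element of `T ⊗[B] N` is recovered from the values of `counit` on its multiples. -/
theorem sum_tmul_counit (z : T ⊗[B] N) : ∑ i, Φ.x i ⊗ₜ[B] Φ.counit N (Φ.y i • z) = z := by
  induction z with
  | zero => simp
  | add z w hz hw => simp only [smul_add, map_add, TensorProduct.tmul_add,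
      Finset.sum_add_distrib, hz, hw]
  | tmul t n =>
    simp only [TensorProduct.smul_tmul', counit_tmul, ← TensorProduct.smul_tmul, smul_eq_mul]
    rw [← TensorProduct.sum_tmul]
    simp only [mul_comm _ t, Φ.sum_form_mul_y]

theorem counit_coinduce (φ : M →ₗ[B] N) (m : M) : Φ.counit N (Φ.coinduce φ m) = φ m := by
  have : ∑ i, Φ.form (Φ.x i) • Φ.y i = 1 := by simpa using Φ.sum_form_mul_x 1
  simp only [coinduce_apply, map_sum, counit_tmul, ← map_smul]
  rw [← map_sum]
  simp only [← smul_assoc, ← Finset.sum_smul, this, one_smul]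

/-- Projective `T`-modules are injective relative to `B`-split monomorphisms. -/
theorem exists_extension {Q : Type u} [AddCommGroup Q] [Module T Q] [Module.Projective T Q]
    {f : M →ₗ[T] P} {r : P →ₗ[B] M} (hr : ∀ m, r (f m) = m) (h : M →ₗ[T] Q) :
    ∃ g : P →ₗ[T] Q, g ∘ₗ f = h := by
  let _ : Module B Q := Module.compHom Q (algebraMap B T)
  have : IsScalarTower B T Q := .of_algebraMap_smul fun _ _ => rfl
  let μ : T ⊗[B] Q →ₗ[T] Q := LinearMap.liftBaseChange T (LinearMap.id : Q →ₗ[B] Q)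
  obtain ⟨s, hs⟩ := Module.projective_lifting_property μ (LinearMap.id : Q →ₗ[T] Q)
    (fun q => ⟨1 ⊗ₜ q, by simp [μ]⟩)
  -- extend `s ∘ h` to `P → T ⊗ Q` through its `B`-linear counterpart, then multiply back to `Q`
  refine ⟨μ ∘ₗ Φ.coinduce (Φ.counit Q ∘ₗ (s ∘ₗ h).restrictScalars B ∘ₗ r),
    LinearMap.ext fun m => ?_⟩
  have key : Φ.coinduce (Φ.counit Q ∘ₗ (s ∘ₗ h).restrictScalars B ∘ₗ r) (f m) = s (h m) := by
    rw [coinduce_apply]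
    simp only [← map_smul, LinearMap.comp_apply, LinearMap.restrictScalars_apply, hr]
    conv_rhs => rw [← Φ.sum_tmul_counit (s (h m))]
    simp only [map_smul]
  rw [LinearMap.comp_apply, LinearMap.comp_apply, key]
  exact DFunLike.congr_fun hs (h m)

/-- Injective `T`-modules are flat relative to `B`-split monomorphisms. -/
theorem rTensor_injective {I : Type u} [AddCommGroup I] [Module T I] [Module.Injective T I]
    {f : M →ₗ[T] P} {r : P →ₗ[B] M} (hr : ∀ m, r (f m) = m) :
    Function.Injective (f.rTensor I) := by
  let _ : Module B I := Module.compHom I (algebraMap B T)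
  have : IsScalarTower B T I := .of_algebraMap_smul fun _ _ => rfl
  let η : I →ₗ[T] T ⊗[B] I := Φ.coinduce LinearMap.id
  have hη : Function.Injective η :=
    Function.LeftInverse.injective (g := Φ.counit I) (Φ.counit_coinduce LinearMap.id)
  obtain ⟨ρ, hρ⟩ := Module.Injective.out η hη LinearMap.id
  -- the retraction `p ⊗ v ↦ ∑ r (x i p) ⊗ ρ (1 ⊗ y i v)` is balanced because of `casimir`
  let ρ₁ : I →ₗ[B] I := ρ.restrictScalars B ∘ₗ TensorProduct.mk B T I 1
  have hρ₁ : ∀ v, ∑ i, Φ.x i • ρ₁ (Φ.y i • v) = v := by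
    intro v
    have := hρ v
    simp only [η, coinduce_apply, map_sum, LinearMap.id_apply] at this
    refine (Finset.sum_congr rfl fun i _ => ?_).trans this
    simp only [ρ₁, LinearMap.comp_apply, LinearMap.restrictScalars_apply, TensorProduct.mk_apply]
    rw [← map_smul, TensorProduct.smul_tmul', smul_eq_mul, mul_one]
  let β : P →+ I →+ M ⊗[T] I :=
    AddMonoidHom.mk' (fun p => AddMonoidHom.mk'
      (fun v => ∑ i, r (Φ.x i • p) ⊗ₜ[T] ρ₁ (Φ.y i • v))
      (fun v w => by simp only [smul_add, map_add, TensorProduct.tmul_add,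
        Finset.sum_add_distrib]))
      (fun p q => by
        ext v
        simp only [smul_add, map_add, TensorProduct.add_tmul, Finset.sum_add_distrib,
          AddMonoidHom.mk'_apply, AddMonoidHom.add_apply])
  have hβ : ∀ (t : T) (p : P) (v : I), β (t • p) v = β p (t • v) := by
    intro t p v
    have := Φ.casimir (((TensorProduct.mk T M I).restrictScalars₁₂ B B).compl₁₂
      (r ∘ₗ (LinearMap.toSpanSingleton T P p).restrictScalars B)
      (ρ₁ ∘ₗ (LinearMap.toSpanSingleton T I v).restrictScalars B)) t
    simpa [β, smul_smul, mul_comm t] using this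
  let R : P ⊗[T] I →+ M ⊗[T] I := TensorProduct.liftAddHom β hβ
  refine Function.LeftInverse.injective (g := R) fun z => ?_
  induction z with
  | zero => simp
  | add z w hz hw => rw [map_add, map_add, hz, hw]
  | tmul m v =>
    simp only [LinearMap.rTensor_tmul, R, TensorProduct.liftAddHom_tmul, β,
      AddMonoidHom.mk'_apply, ← map_smul, hr]
    simp only [TensorProduct.smul_tmul]
    rw [← TensorProduct.tmul_sum, hρ₁]

end Modules

omit Φ in
/-- A Frobenius algebra over a field is injective as a module over itself. -/
theorem injective_self {K : Type u} [Field K] [Algebra K T] (Ψ : FrobeniusSystem K T) :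
    Module.Injective T T where
  out X Y _ _ _ _ f hf g := by
    let _ : Module K X := Module.compHom X (algebraMap K T)
    have : IsScalarTower K T X := .of_algebraMap_smul fun _ _ => rfl
    let _ : Module K Y := Module.compHom Y (algebraMap K T)
    have : IsScalarTower K T Y := .of_algebraMap_smul fun _ _ => rfl
    obtain ⟨r, hr⟩ := LinearMap.exists_leftInverse_of_injective (f.restrictScalars K)
      (LinearMap.ker_eq_bot.2 hf)
    obtain ⟨k, hk⟩ := Ψ.exists_extension (f := f) (r := r) (DFunLike.congr_fun hr) g
    exact ⟨k, DFunLike.congr_fun hk⟩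

end FrobeniusSystem

end Frobenius

/-! ### Complete resolutions over a Frobenius extension -/

/-- A relation in which every element satisfying `p` has a predecessor and a successor satisfying
`p` has two-sided infinite chains through each such element. -/
theorem exists_int_chain {α : Type*} {p : α → Prop} {r : α → α → Prop}
    (hr : ∀ a, p a → ∃ b, p b ∧ r a b) (hl : ∀ a, p a → ∃ b, p b ∧ r b a) (a : α) (ha : p a) :
    ∃ s : ℤ → α, s 1 = a ∧ ∀ i, r (s i) (s (i + 1)) := by
  choose! R hR using hr
  choose! L hL using hl
  have hRp : ∀ n : ℕ, p (R^[n] a) := fun n => by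
    induction n with
    | zero => exact ha
    | succ n ih => rw [Function.iterate_succ_apply']; exact (hR _ ih).1
  have hLp : ∀ n : ℕ, p (L^[n] a) := fun n => by
    induction n with
    | zero => exact ha
    | succ n ih => rw [Function.iterate_succ_apply']; exact (hL _ ih).1
  -- `s` starts from `a` at `0`, with the successors of `a` at positive arguments
  let s : ℤ → α := fun i => Int.rec (fun n => R^[n] a) (fun n => L^[n + 1] a) i
  have hs : ∀ i, r (s i) (s (i + 1)) := by
    rintro (n | _ | n)
    · change r (R^[n] a) (R^[n + 1] a)
      rw [Function.iterate_succ_apply']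
      exact (hR _ (hRp n)).2
    · exact (hL a ha).2
    · change r (L^[n + 2] a) (L^[n + 1] a)
      rw [Function.iterate_succ_apply' L (n + 1)]
      exact (hL _ (hLp (n + 1))).2
  refine ⟨fun i => s (i - 1), rfl, fun i => ?_⟩
  have := hs (i - 1)
  rwa [sub_add_eq_add_sub] at this

section RelativeProjectives

open scoped TensorProduct

variable {B T : Type u} [CommRing B] [CommRing T] [Algebra B T]

/-- The `T`-module `M` is projective as a module over `B`. An object of `ModuleCat T` carries no
`B`-module structure; the one compatible with that of `T` is quantified existentially. -/
def IsProjectiveOver (B : Type u) [CommRing B] {T : Type u} [CommRing T] [Algebra B T]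
    (M : ModuleCat.{u} T) : Prop :=
  ∃ _ : Module B M, IsScalarTower B T M ∧ Module.Projective B M

/-- There is a `B`-split short exact sequence `0 → M → P → N → 0` of `T`-modules in which `P` is
projective. The retraction is recorded through its values, so that no `B`-module structures have
to be chosen. -/
def IsSplitStep (B : Type u) [CommRing B] {T : Type u} [CommRing T] [Algebra B T]
    (M N : ModuleCat.{u} T) : Prop :=
  ∃ (P : ModuleCat.{u} T) (f : M →ₗ[T] P) (g : P →ₗ[T] N) (r : P →+ M),
    Module.Projective T P ∧ (∀ m, r (f m) = m) ∧
    (∀ (b : B) (p : P), r (algebraMap B T b • p) = algebraMap B T b • r p) ∧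
    Function.Exact f g ∧ Function.Surjective g

namespace FrobeniusSystem

variable (Φ : FrobeniusSystem B T)
include Φ

/-- The module `M` embeds in `T ⊗[B] M` by the coinduction of its identity, with the retraction
`counit`. -/
theorem exists_isSplitStep_right (M : ModuleCat.{u} T) (hM : IsProjectiveOver B M) :
    ∃ N : ModuleCat.{u} T, IsProjectiveOver B N ∧ IsSplitStep B M N := by
  obtain ⟨_, _, _⟩ := hM
  have := Φ.projective
  let η : M →ₗ[T] T ⊗[B] M := Φ.coinduce LinearMap.id
  have hη : ∀ m, Φ.counit M (η m) = m := Φ.counit_coinduce LinearMap.id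
  let q : T ⊗[B] M →ₗ[T] (T ⊗[B] M) ⧸ LinearMap.range η := (LinearMap.range η).mkQ
  refine ⟨ModuleCat.of T ((T ⊗[B] M) ⧸ LinearMap.range η), ⟨inferInstance, inferInstance, ?_⟩,
    ModuleCat.of T (T ⊗[B] M), η, q, (Φ.counit M).toAddMonoidHom,
    (inferInstance : Module.Projective T (T ⊗[B] M)), hη, fun b p => ?_,
    LinearMap.exact_iff.2 (LinearMap.range η).ker_mkQ, (LinearMap.range η).mkQ_surjective⟩
  · let σ : T ⊗[B] M →ₗ[B] T ⊗[B] M := LinearMap.id - η.restrictScalars B ∘ₗ Φ.counit M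
    let σ' : ((T ⊗[B] M) ⧸ LinearMap.range η) →ₗ[B] T ⊗[B] M :=
      ((LinearMap.range η).restrictScalars B).liftQ σ (by
        rintro _ ⟨m, rfl⟩
        simp [σ, hη])
    refine Module.Projective.of_split σ' (q.restrictScalars B) (LinearMap.ext fun z => ?_)
    obtain ⟨z, rfl⟩ := (LinearMap.range η).mkQ_surjective z
    change q (z - η (Φ.counit M z)) = q z
    rw [map_sub, sub_eq_self]
    exact (Submodule.Quotient.mk_eq_zero _).2 ⟨_, rfl⟩
  · change Φ.counit M (algebraMap B T b • p) = algebraMap B T b • Φ.counit M p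
    rw [algebraMap_smul, algebraMap_smul, map_smul]

/-- The multiplication map `T ⊗[B] M → M` has the `B`-linear section `m ↦ 1 ⊗ m`. -/
theorem exists_isSplitStep_left (M : ModuleCat.{u} T) (hM : IsProjectiveOver B M) :
    ∃ N : ModuleCat.{u} T, IsProjectiveOver B N ∧ IsSplitStep B N M := by
  obtain ⟨_, _, _⟩ := hM
  have := Φ.projective
  let μ : T ⊗[B] M →ₗ[T] M := LinearMap.liftBaseChange T (LinearMap.id : M →ₗ[B] M)
  have hμ : ∀ m, μ (1 ⊗ₜ m) = m := fun m => by simp [μ]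
  let ρ : T ⊗[B] M →ₗ[B] LinearMap.ker μ :=
    (LinearMap.id - TensorProduct.mk B T M 1 ∘ₗ μ.restrictScalars B).codRestrict
      ((LinearMap.ker μ).restrictScalars B) (fun z => by simp [hμ])
  have hρ : ∀ z, ρ ((LinearMap.ker μ).subtype z) = z := by
    rintro ⟨z, hz⟩
    ext
    have : μ z = 0 := hz
    change z - 1 ⊗ₜ μ z = z
    rw [this, TensorProduct.tmul_zero, sub_zero]
  refine ⟨ModuleCat.of T (LinearMap.ker μ), ⟨inferInstance, inferInstance, ?_⟩,
    ModuleCat.of T (T ⊗[B] M), (LinearMap.ker μ).subtype, μ, ρ.toAddMonoidHom,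
    (inferInstance : Module.Projective T (T ⊗[B] M)), hρ, fun b p => ?_, exact_ker_subtype μ,
    fun m => ⟨_, hμ m⟩⟩
  · exact Module.Projective.of_split ((LinearMap.ker μ).subtype.restrictScalars B) ρ
      (LinearMap.ext hρ)
  · change ρ (algebraMap B T b • p) = algebraMap B T b • ρ p
    rw [algebraMap_smul, algebraMap_smul, map_smul]

theorem exists_extension_of_add {M P : ModuleCat.{u} T} {f : M →ₗ[T] P} {r : P →+ M}
    (hr : ∀ m, r (f m) = m)
    (hrb : ∀ (b : B) (p : P), r (algebraMap B T b • p) = algebraMap B T b • r p)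
    {Q : ModuleCat.{u} T} (hQ : Module.Projective T Q) (h : M →ₗ[T] Q) :
    ∃ g : P →ₗ[T] Q, g ∘ₗ f = h := by
  let _ : Module B M := Module.compHom M (algebraMap B T)
  have : IsScalarTower B T M := .of_algebraMap_smul fun _ _ => rfl
  let _ : Module B P := Module.compHom P (algebraMap B T)
  have : IsScalarTower B T P := .of_algebraMap_smul fun _ _ => rfl
  exact Φ.exists_extension (r := { r with map_smul' := hrb }) hr h

theorem rTensor_injective_of_add {M P : ModuleCat.{u} T} {f : M →ₗ[T] P} {r : P →+ M}
    (hr : ∀ m, r (f m) = m)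
    (hrb : ∀ (b : B) (p : P), r (algebraMap B T b • p) = algebraMap B T b • r p)
    {I : ModuleCat.{u} T} (hI : Module.Injective T I) : Function.Injective (f.rTensor I) := by
  let _ : Module B M := Module.compHom M (algebraMap B T)
  have : IsScalarTower B T M := .of_algebraMap_smul fun _ _ => rfl
  let _ : Module B P := Module.compHom P (algebraMap B T)
  have : IsScalarTower B T P := .of_algebraMap_smul fun _ _ => rfl
  exact Φ.rTensor_injective (r := { r with map_smul' := hrb }) hr

/-- Over a Frobenius extension `T` of `B`, a `T`-module which is projective over `B` is Gorenstein
projective and Gorenstein flat: splicing `B`-split sequences `0 → M → T ⊗ M → N → 0` and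
`0 → L → T ⊗ M → M → 0` gives a complete resolution. -/
theorem isGorenstein_of_isProjectiveOver (M : ModuleCat.{u} T) (hM : IsProjectiveOver B M) :
    IsGorensteinProjective T M ∧ IsGorensteinFlat T M := by
  obtain ⟨s, rfl, hs⟩ := exists_int_chain Φ.exists_isSplitStep_right Φ.exists_isSplitStep_left M hM
  choose P f g r hP hr hrb hfg hg using hs
  have hf : ∀ i, Function.Injective (f i) := fun i =>
    Function.LeftInverse.injective (g := r i) (hr i)
  let d : ∀ i : ℤ, P i →ₗ[T] P (i + 1) := fun i => f (i + 1) ∘ₗ g i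
  have hd : ∀ i, Function.Exact (d i) (d (i + 1)) := by
    intro i x
    change f (i + 1 + 1) (g (i + 1) x) = 0 ↔ _
    rw [map_eq_zero_iff _ (hf _), hfg (i + 1) x]
    constructor
    · rintro ⟨y, rfl⟩
      obtain ⟨z, rfl⟩ := hg i y
      exact ⟨z, rfl⟩
    · rintro ⟨z, rfl⟩
      exact ⟨g i z, rfl⟩
  have he : Nonempty (s 1 ≃ₗ[T] LinearMap.range (d 0)) := by
    have : LinearMap.range (d 0) = LinearMap.range (f (0 + 1)) :=
      LinearMap.range_comp_of_range_eq_top _ (LinearMap.range_eq_top.2 (hg 0))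
    rw [this]
    exact ⟨LinearEquiv.ofInjective (f (0 + 1)) (hf (0 + 1))⟩
  refine ⟨⟨P, d, hP, hd, fun Q hQ i h => ⟨fun hh => ?_, ?_⟩, he⟩,
    ⟨P, d, fun i => ?_, hd, fun I hI i z => ⟨fun hz => ?_, ?_⟩, he⟩⟩
  · have hh' : h ∘ₗ f (i + 1) = 0 := by
      ext y
      obtain ⟨z, rfl⟩ := hg i y
      exact DFunLike.congr_fun hh z
    obtain ⟨k, hk⟩ : ∃ k : s (i + 1 + 1) →ₗ[T] Q, k ∘ₗ g (i + 1) = h := by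
      have hle : LinearMap.ker (g (i + 1)) ≤ LinearMap.ker h := fun x hx => by
        obtain ⟨y, rfl⟩ := (hfg (i + 1) x).1 hx
        exact DFunLike.congr_fun hh' y
      let e := LinearMap.quotKerEquivOfSurjective (g (i + 1)) (hg (i + 1))
      refine ⟨(LinearMap.ker (g (i + 1))).liftQ h hle ∘ₗ e.symm.toLinearMap,
        LinearMap.ext fun x => ?_⟩
      have : e.symm (g (i + 1) x) = (LinearMap.ker (g (i + 1))).mkQ x := by
        rw [LinearEquiv.symm_apply_eq]; rfl
      simp [this]
    obtain ⟨k', hk'⟩ := Φ.exists_extension_of_add (hr (i + 1 + 1)) (hrb (i + 1 + 1)) hQ k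
    refine ⟨k', ?_⟩
    change k' ∘ₗ f (i + 1 + 1) ∘ₗ g (i + 1) = h
    rw [← LinearMap.comp_assoc, hk', hk]
  · rintro ⟨k, rfl⟩
    ext x
    change k (d (i + 1) (d i x)) = 0
    rw [(hd i).apply_apply_eq_zero, map_zero]
  · have := hP i
    infer_instance
  · change ((f (i + 1 + 1) ∘ₗ g (i + 1)).rTensor I) z = 0 at hz
    rw [LinearMap.rTensor_comp, LinearMap.comp_apply, map_eq_zero_iff _
      (Φ.rTensor_injective_of_add (hr (i + 1 + 1)) (hrb (i + 1 + 1)) hI)] at hz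
    obtain ⟨w, rfl⟩ := (rTensor_exact I (hfg (i + 1)) (hg (i + 1)) z).1 hz
    obtain ⟨v, rfl⟩ := LinearMap.rTensor_surjective I (hg i) w
    exact ⟨v, by rw [← LinearMap.comp_apply, ← LinearMap.rTensor_comp]⟩
  · rintro ⟨w, rfl⟩
    rw [← LinearMap.comp_apply, ← LinearMap.rTensor_comp]
    have : d (i + 1) ∘ₗ d i = 0 := LinearMap.ext fun x => (hd i).apply_apply_eq_zero x
    rw [this, LinearMap.rTensor_zero, LinearMap.zero_apply]

/-- Dimension shifting along `0 → L → T ⊗[B] M → M → 0` leads to `Ext^1`, where every map from `L`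
to the projective module `Q` extends because the sequence is `B`-split. -/
theorem subsingleton_ext_of_isProjectiveOver (Q : ModuleCat.{u} T) (hQ : Module.Projective T Q)
    (i : ℕ) (M : ModuleCat.{u} T) (hM : IsProjectiveOver B M) :
    Subsingleton (Abelian.Ext.{u} M Q (i + 1)) := by
  induction i generalizing M with
  | zero =>
    obtain ⟨N, hN, P, f, g, r, hP, hr, hrb, hfg, hg⟩ := Φ.exists_isSplitStep_left M hM
    have hf : Function.Injective f := Function.LeftInverse.injective (g := r) hr
    have hS := shortExact_mk hf hfg hg
    have : Projective P := (IsProjective.iff_projective P).1 hP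
    refine subsingleton_of_forall_eq 0 fun x => ?_
    obtain ⟨y, rfl⟩ := Abelian.Ext.contravariant_sequence_exact₃ hS Q x
      (Abelian.Ext.eq_zero_of_projective _) (add_comm 1 0)
    obtain ⟨φ, rfl⟩ := (Abelian.Ext.mk₀_bijective _ _).2 y
    obtain ⟨ψ, hψ⟩ := Φ.exists_extension_of_add hr hrb hQ φ.hom
    have : φ = ModuleCat.ofHom f ≫ ModuleCat.ofHom ψ := by
      ext x
      exact (DFunLike.congr_fun hψ x).symm
    rw [this, ← Abelian.Ext.mk₀_comp_mk₀]
    exact hS.extClass_comp_assoc _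
  | succ i ih =>
    obtain ⟨N, hN, P, f, g, r, hP, hr, hrb, hfg, hg⟩ := Φ.exists_isSplitStep_left M hM
    have hS := shortExact_mk (Function.LeftInverse.injective (g := r) hr) hfg hg
    have : Projective P := (IsProjective.iff_projective P).1 hP
    have := ih N hN
    refine subsingleton_of_forall_eq 0 fun x => ?_
    obtain ⟨y, rfl⟩ := Abelian.Ext.contravariant_sequence_exact₃ hS Q x
      (Abelian.Ext.eq_zero_of_projective _) (add_comm 1 (i + 1))
    rw [Subsingleton.elim y 0, Abelian.Ext.comp_zero]

theorem subsingleton_ext_of_hasResolutionLE (Q : ModuleCat.{u} T) (hQ : Module.Projective T Q)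
    (n : ℕ) (M : ModuleCat.{u} T) (hM : HasResolutionLE T (IsProjectiveOver B) n M) :
    Subsingleton (Abelian.Ext.{u} M Q (n + 1)) := by
  induction n generalizing M with
  | zero => exact Φ.subsingleton_ext_of_isProjectiveOver Q hQ 0 M hM
  | succ n ih =>
    obtain ⟨X, p, hX, hp, hK⟩ := hM
    have hS := shortExact_mk (Submodule.subtype_injective _) (exact_ker_subtype p) hp
    have hX' := Φ.subsingleton_ext_of_isProjectiveOver Q hQ (n + 1) X hX
    have := ih _ hK
    refine subsingleton_of_forall_eq 0 fun x => ?_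
    obtain ⟨y, rfl⟩ := Abelian.Ext.contravariant_sequence_exact₃ hS Q x
      (hX'.elim _ _) (add_comm 1 (n + 1))
    rw [Subsingleton.elim y 0, Abelian.Ext.comp_zero]

/-- A syzygy of order `n` is projective over `B` as soon as the projective dimension over `B` is
at most `n`. -/
theorem hasResolutionLE_isProjectiveOver (n : ℕ) (M : Type u) [AddCommGroup M] [Module B M]
    [Module T M] [IsScalarTower B T M] (h : HasProjectiveDimensionLE (ModuleCat.of B M) n) :
    HasResolutionLE T (IsProjectiveOver B) n (ModuleCat.of T M) := by
  induction n generalizing M with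
  | zero => exact ⟨inferInstance, inferInstance, (hasProjectiveDimensionLE_zero_iff _).1 h⟩
  | succ n ih =>
    let p : (M →₀ T) →ₗ[T] M := Finsupp.linearCombination T id
    have hp : Function.Surjective p := Finsupp.linearCombination_id_surjective T M
    have := Φ.projective
    have hproj := projective_finsupp (B := B) (ι := M) (P := T)
    refine ⟨ModuleCat.of T (M →₀ T), p, ⟨inferInstance, inferInstance, hproj⟩, hp, ih _ ?_⟩
    exact hasProjectiveDimensionLE_left (f := (LinearMap.ker p).subtype.restrictScalars B)
      (g := p.restrictScalars B) (Submodule.subtype_injective _) (exact_ker_subtype p) hp n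
      (hasProjectiveDimensionLE_of_projective _) h

variable {n : ℕ} (hB : ∀ N : ModuleCat.{u} B, HasProjectiveDimensionLE N n)
include hB

theorem hasResolutionLE_of_forall (M : ModuleCat.{u} T) :
    HasResolutionLE T (IsProjectiveOver B) n M := by
  let _ : Module B M := Module.compHom M (algebraMap B T)
  have : IsScalarTower B T M := .of_algebraMap_smul fun _ _ => rfl
  exact Φ.hasResolutionLE_isProjectiveOver n M (hB (ModuleCat.of B M))

theorem Ggldim_le : Ggldim T ≤ n :=
  iSup_le fun M => iInf₂_le n ((Φ.hasResolutionLE_of_forall hB M).imp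
    (fun N hN => (Φ.isGorenstein_of_isProjectiveOver N hN).1) n)

theorem wGgldim_le : wGgldim T ≤ n :=
  iSup_le fun M => iInf₂_le n ((Φ.hasResolutionLE_of_forall hB M).imp
    (fun N hN => (Φ.isGorenstein_of_isProjectiveOver N hN).2) n)

theorem subsingleton_ext (M Q : ModuleCat.{u} T) (hQ : Module.Projective T Q) :
    Subsingleton (Abelian.Ext.{u} M Q (n + 1)) :=
  Φ.subsingleton_ext_of_hasResolutionLE Q hQ n M (Φ.hasResolutionLE_of_forall hB M)

/-- Over a Frobenius extension of a ring of finite global dimension, injective modules have finite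
projective dimension, being direct summands of induced modules. -/
theorem hasProjectiveDimensionLE_of_injective (I : ModuleCat.{u} T) (hI : Module.Injective T I) :
    HasProjectiveDimensionLE I n := by
  let _ : Module B I := Module.compHom I (algebraMap B T)
  have : IsScalarTower B T I := .of_algebraMap_smul fun _ _ => rfl
  have := Φ.projective
  let η : I →ₗ[T] T ⊗[B] I := Φ.coinduce LinearMap.id
  have hη : Function.Injective η :=
    Function.LeftInverse.injective (g := Φ.counit I) (Φ.counit_coinduce LinearMap.id)
  obtain ⟨ρ, hρ⟩ := Module.Injective.out η hη LinearMap.id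
  exact hasProjectiveDimensionLE_of_retract (M₁ := I) η ρ (LinearMap.ext hρ) n
    (hasProjectiveDimensionLE_baseChange n I (hB (ModuleCat.of B I)))

end FrobeniusSystem

end RelativeProjectives

/-! ### Left derived functors above the projective dimension -/

section LeftDerived

variable {T : Type u} [CommRing T]

/-- The cokernel of the differential into degree `i` of a projective resolution of a module of
projective dimension at most `n` has projective dimension at most `n - i`. -/
theorem hasProjectiveDimensionLE_cokernel {n : ℕ} {X : ModuleCat.{u} T}
    (hX : HasProjectiveDimensionLE X n) (P : ProjectiveResolution X) (i j : ℕ) (hij : i + j = n) :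
    HasProjectiveDimensionLE (ModuleCat.of T
      (P.complex.X i ⧸ LinearMap.range (P.complex.d (i + 1) i).hom)) j := by
  induction i generalizing j with
  | zero =>
    obtain rfl : j = n := by lia
    have hex := (ShortComplex.ShortExact.moduleCat_exact_iff_function_exact _).1 P.exact₀
    have hsurj := (ModuleCat.epi_iff_surjective (P.π.f 0)).1 inferInstance
    have hX' := hasProjectiveDimensionLT_of_iso
      (HomologicalComplex.singleObjXSelf (ComplexShape.down ℕ) 0 X).symm (j + 1)
    let e := hex.linearEquivOfSurjective hsurj
    exact hasProjectiveDimensionLE_of_retract e.toLinearMap e.symm.toLinearMap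
      (LinearMap.ext e.symm_apply_apply) j hX'
  | succ i ih =>
    have hcok := ih (j + 1) (by lia)
    have hproj : Module.Projective T (P.complex.X i) :=
      (IsProjective.iff_projective _).2 (P.projective i)
    have hr := hasProjectiveDimensionLE_left
      (f := (LinearMap.range (P.complex.d (i + 1) i).hom).subtype)
      (g := (LinearMap.range (P.complex.d (i + 1) i).hom).mkQ) (Submodule.subtype_injective _)
      (LinearMap.exact_subtype_mkQ _) (Submodule.mkQ_surjective _) j
      (hasProjectiveDimensionLE_of_projective _) hcok
    have hex := LinearMap.exact_iff.1
      ((ShortComplex.ShortExact.moduleCat_exact_iff_function_exact _).1 (P.exact_succ i))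
    let e := (Submodule.quotEquivOfEq _ _ hex.symm).trans
      (LinearMap.quotKerEquivRange (P.complex.d (i + 1) i).hom)
    exact hasProjectiveDimensionLE_of_retract e.toLinearMap e.symm.toLinearMap (by simp) j hr

/-- An exact sequence `P₂ → P₁ → P₀` of projective modules for which the cokernel of `P₁ → P₀` is
projective has a contracting homotopy at `P₁`. -/
theorem exists_homotopy_of_projective_cokernel {P₀ P₁ P₂ : Type u} [AddCommGroup P₀]
    [AddCommGroup P₁] [AddCommGroup P₂] [Module T P₀] [Module T P₁] [Module T P₂]
    [Module.Projective T P₀] [Module.Projective T P₁] {d₂ : P₂ →ₗ[T] P₁} {d₁ : P₁ →ₗ[T] P₀}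
    (hex : Function.Exact d₂ d₁) (hproj : Module.Projective T (P₀ ⧸ LinearMap.range d₁)) :
    ∃ (s : P₀ →ₗ[T] P₁) (h : P₁ →ₗ[T] P₂), d₂ ∘ₗ h + s ∘ₗ d₁ = LinearMap.id := by
  obtain ⟨σ, hσ⟩ := Module.projective_lifting_property (LinearMap.range d₁).mkQ LinearMap.id
    (LinearMap.range d₁).mkQ_surjective
  have hσ' : ∀ q, (LinearMap.range d₁).mkQ (σ q) = q := DFunLike.congr_fun hσ
  let ρ : P₀ →ₗ[T] LinearMap.range d₁ :=
    (LinearMap.id - σ ∘ₗ (LinearMap.range d₁).mkQ).codRestrict _ fun p => by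
      refine (Submodule.Quotient.mk_eq_zero _).1 ?_
      change (LinearMap.range d₁).mkQ (p - σ ((LinearMap.range d₁).mkQ p)) = 0
      rw [map_sub, hσ', sub_self]
  have hρ : ∀ x, ρ (d₁ x) = d₁.rangeRestrict x := by
    intro x
    ext
    have : (LinearMap.range d₁).mkQ (d₁ x) = 0 := by simp
    change d₁ x - σ ((LinearMap.range d₁).mkQ (d₁ x)) = d₁ x
    rw [this, map_zero, sub_zero]
  have : Module.Projective T (LinearMap.range d₁) := by
    refine Module.Projective.of_split (LinearMap.range d₁).subtype ρ (LinearMap.ext ?_)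
    rintro ⟨_, x, rfl⟩
    exact hρ x
  obtain ⟨θ, hθ⟩ := Module.projective_lifting_property d₁.rangeRestrict LinearMap.id
    d₁.surjective_rangeRestrict
  have hθ' : ∀ y, d₁.rangeRestrict (θ y) = y := DFunLike.congr_fun hθ
  let κ : P₁ →ₗ[T] LinearMap.range d₂ :=
    (LinearMap.id - (θ ∘ₗ ρ) ∘ₗ d₁).codRestrict _ fun x => by
      rw [← LinearMap.exact_iff.1 hex, LinearMap.mem_ker]
      have := congrArg Subtype.val (hθ' (d₁.rangeRestrict x))
      simp only [LinearMap.sub_apply, LinearMap.id_apply, LinearMap.comp_apply, map_sub, hρ]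
      exact sub_eq_zero.2 this.symm
  obtain ⟨h, hh⟩ := Module.projective_lifting_property d₂.rangeRestrict κ
    d₂.surjective_rangeRestrict
  refine ⟨θ ∘ₗ ρ, h, LinearMap.ext fun x => ?_⟩
  have : d₂ (h x) = x - θ (ρ (d₁ x)) := congrArg Subtype.val (DFunLike.congr_fun hh x)
  simp [this]

/-- Left derived functors vanish above the projective dimension: in a projective resolution of `X`
the differential splits beyond the projective dimension of `X`. -/
theorem isZero_leftDerived_of_hasProjectiveDimensionLE (F : ModuleCat.{u} T ⥤ ModuleCat.{u} T)
    [F.Additive] {n : ℕ} {X : ModuleCat.{u} T} (hX : HasProjectiveDimensionLE X n) :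
    Limits.IsZero ((F.leftDerived (n + 1)).obj X) := by
  let P := projectiveResolution X
  refine Limits.IsZero.of_iso ?_ (P.isoLeftDerivedObj F (n + 1))
  have hproj : ∀ i, Module.Projective T (P.complex.X i) := fun i =>
    (IsProjective.iff_projective _).2 (P.projective i)
  have := hproj n
  have := hproj (n + 1)
  obtain ⟨s, h, hsh⟩ := exists_homotopy_of_projective_cokernel
    ((ShortComplex.ShortExact.moduleCat_exact_iff_function_exact _).1 (P.exact_succ n))
    ((hasProjectiveDimensionLE_zero_iff _).1
      (hasProjectiveDimensionLE_cokernel hX P n 0 (add_zero n)))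
  have hsh' : ModuleCat.ofHom h ≫ P.complex.d (n + 2) (n + 1) +
      P.complex.d (n + 1) n ≫ ModuleCat.ofHom s = 𝟙 _ := by
    ext x
    exact DFunLike.congr_fun hsh x
  have hF := congrArg F.map hsh'
  rw [F.map_add, F.map_comp, F.map_comp, F.map_id] at hF
  refine (HomologicalComplex.exactAt_iff_isZero_homology _ _).1
    ((HomologicalComplex.exactAt_iff' _ (n + 2) (n + 1) n (by simp only [ChainComplex.prev]; rfl)
      (by simp)).2 ((ShortComplex.moduleCat_exact_iff _).2 fun x hx => ?_))
  refine ⟨F.map (ModuleCat.ofHom h) x, ?_⟩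
  have hFx : (F.map (P.complex.d (n + 2) (n + 1))).hom ((F.map (ModuleCat.ofHom h)).hom x) +
      (F.map (ModuleCat.ofHom s)).hom ((F.map (P.complex.d (n + 1) n)).hom x) = x :=
    congrArg (fun φ => φ.hom x) hF
  have hx' : (F.map (P.complex.d (n + 1) n)).hom x = 0 := hx
  rw [hx', map_zero, add_zero] at hFx
  exact hFx

end LeftDerived

/-! ### Frobenius systems on the rings in question -/

section Systems

variable {B T : Type u} [CommRing B] [CommRing T] [Algebra B T]

/-- The coefficient of `X ^ m` as a linear form on `K[X]/(X ^ (m + 1))`. -/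
def truncForm (K : Type u) [Field K] (m : ℕ) : TruncPoly K (m + 1) →ₗ[K] K :=
  ((Ideal.span {(Polynomial.X : Polynomial K) ^ (m + 1)}).restrictScalars K).liftQ
    (Polynomial.lcoeff K m) fun p hp => by
      have hp : p ∈ Ideal.span {(Polynomial.X : Polynomial K) ^ (m + 1)} := hp
      rw [Ideal.mem_span_singleton, Polynomial.X_pow_dvd_iff] at hp
      exact hp m m.lt_succ_self

theorem truncForm_mk (K : Type u) [Field K] (m : ℕ) (p : Polynomial K) :
    truncForm K m (Ideal.Quotient.mk _ p) = p.coeff m := rfl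

theorem smul_mk_eq (K : Type u) [Field K] (m : ℕ) (c : K) (p : Polynomial K) :
    c • (Ideal.Quotient.mk (Ideal.span {(Polynomial.X : Polynomial K) ^ m}) p) =
      Ideal.Quotient.mk _ (Polynomial.C c * p) := by
  rw [← Polynomial.smul_eq_C_mul]; rfl

theorem sum_truncForm_smul (K : Type u) [Field K] (m : ℕ) (a : TruncPoly K (m + 1)) :
    ∑ i : Fin (m + 1), truncForm K m (a * truncX K (m + 1) ^ (m - i : ℕ)) •
      truncX K (m + 1) ^ (i : ℕ) = a := by
  obtain ⟨p, rfl⟩ := Ideal.Quotient.mk_surjective a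
  have h : ∀ i : Fin (m + 1), (p * Polynomial.X ^ (m - i : ℕ)).coeff m = p.coeff i := by
    intro i
    rw [Polynomial.coeff_mul_X_pow', if_pos (Nat.sub_le _ _), Nat.sub_sub_self (by lia)]
  simp only [truncX, ← map_pow, ← map_mul, truncForm_mk, smul_mk_eq, h, ← map_sum]
  rw [← sub_eq_zero, ← map_sub, mk_eq_zero_iff_coeff]
  intro j hj
  simp only [Polynomial.coeff_sub, Polynomial.finsetSum_coeff, Polynomial.coeff_C_mul,
    Polynomial.coeff_X_pow, mul_ite, mul_one, mul_zero]
  rw [Finset.sum_eq_single (⟨j, hj⟩ : Fin (m + 1))]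
  · simp
  · intro b _ hb
    rw [if_neg fun h => hb (Fin.ext h.symm)]
  · simp

/-- The Frobenius system on `K[X]/(X ^ (m + 1))`: the monomials, paired by the top coefficient. -/
def truncSystem (K : Type u) [Field K] (m : ℕ) : FrobeniusSystem K (TruncPoly K (m + 1)) where
  ι := Fin (m + 1)
  form := truncForm K m
  x i := truncX K (m + 1) ^ (m - i : ℕ)
  y i := truncX K (m + 1) ^ (i : ℕ)
  sum_form_mul_x := sum_truncForm_smul K m
  sum_form_mul_y a := by
    conv_rhs => rw [← sum_truncForm_smul K m a]
    refine Fintype.sum_equiv Fin.revPerm _ _ fun i => ?_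
    simp only [Fin.revPerm_apply, Fin.val_rev]
    rw [show m - (m + 1 - (i + 1 : ℕ)) = i by lia, show m + 1 - (i + 1 : ℕ) = m - i by lia]

/-- The `B × S`-algebra structure on `T × S`. It is an instance only locally, since it overlaps
with `Algebra.id`. -/
abbrev prodAlgebra (B T S : Type u) [CommRing B] [CommRing T] [Algebra B T] [CommRing S] :
    Algebra (B × S) (T × S) :=
  (RingHom.prodMap (algebraMap B T) (RingHom.id S)).toAlgebra

attribute [local instance] prodAlgebra

theorem prod_smul_def (S : Type u) [CommRing S] (c : B × S) (a : T × S) :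
    c • a = (c.1 • a.1, c.2 * a.2) := by
  rw [Algebra.smul_def c.1]; rfl

/-- The product of a Frobenius system with the trivial one on a ring `S`. -/
def FrobeniusSystem.prod (Φ : FrobeniusSystem B T) (S : Type u) [CommRing S] :
    FrobeniusSystem (B × S) (T × S) where
  ι := Option Φ.ι
  form :=
    { toFun := fun a => (Φ.form a.1, a.2)
      map_add' := fun a b => by simp
      map_smul' := fun c a => by ext <;> simp [prod_smul_def] }
  x i := i.elim (0, 1) fun i => (Φ.x i, 0)
  y i := i.elim (0, 1) fun i => (Φ.y i, 0)
  sum_form_mul_x a := by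
    simp only [Fintype.sum_option, prod_smul_def]
    ext <;> simp [Prod.fst_sum, Prod.snd_sum, Φ.sum_form_mul_x]
  sum_form_mul_y a := by
    simp only [Fintype.sum_option, prod_smul_def]
    ext <;> simp [Prod.fst_sum, Prod.snd_sum, Φ.sum_form_mul_y]

attribute [local instance] MvPolynomial.algebraMvPolynomial

theorem coeff_sum_support_monomial {σ : Type} (φ : T →ₗ[B] B) (p : MvPolynomial σ T) (m : σ →₀ ℕ) :
    (∑ k ∈ p.support, MvPolynomial.monomial k (φ (p.coeff k))).coeff m = φ (p.coeff m) := by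
  classical
  simp only [MvPolynomial.coeff_sum, MvPolynomial.coeff_monomial, Finset.sum_ite_eq']
  split_ifs with h
  · rfl
  · rw [MvPolynomial.notMem_support_iff.1 h, map_zero]

/-- A linear form on `T`, applied to the coefficients of a polynomial. -/
def mvPolynomialForm (σ : Type) (φ : T →ₗ[B] B) :
    MvPolynomial σ T →ₗ[MvPolynomial σ B] MvPolynomial σ B where
  toFun p := ∑ m ∈ p.support, MvPolynomial.monomial m (φ (p.coeff m))
  map_add' p q := by
    ext m
    rw [MvPolynomial.coeff_add, coeff_sum_support_monomial, coeff_sum_support_monomial,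
      coeff_sum_support_monomial, MvPolynomial.coeff_add, map_add]
  map_smul' q p := by
    classical
    ext m
    rw [coeff_sum_support_monomial, RingHom.id_apply, smul_eq_mul, Algebra.smul_def,
      MvPolynomial.algebraMap_def, MvPolynomial.coeff_mul, MvPolynomial.coeff_mul, map_sum]
    refine Finset.sum_congr rfl fun x _ => ?_
    rw [coeff_sum_support_monomial, MvPolynomial.coeff_map, ← Algebra.smul_def, map_smul,
      smul_eq_mul]

theorem coeff_mvPolynomialForm (σ : Type) (φ : T →ₗ[B] B) (p : MvPolynomial σ T) (m : σ →₀ ℕ) :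
    (mvPolynomialForm σ φ p).coeff m = φ (p.coeff m) :=
  coeff_sum_support_monomial φ p m

/-- The Frobenius system on polynomial rings, with the same dual families and the form applied to
coefficients. -/
def FrobeniusSystem.mvPolynomial (Φ : FrobeniusSystem B T) (σ : Type) :
    FrobeniusSystem (MvPolynomial σ B) (MvPolynomial σ T) where
  ι := Φ.ι
  form := mvPolynomialForm σ Φ.form
  x i := MvPolynomial.C (Φ.x i)
  y i := MvPolynomial.C (Φ.y i)
  sum_form_mul_x a := by
    ext m
    simp only [MvPolynomial.coeff_sum, Algebra.smul_def, MvPolynomial.algebraMap_def,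
      mul_comm _ (MvPolynomial.C _), MvPolynomial.coeff_C_mul, MvPolynomial.coeff_map,
      coeff_mvPolynomialForm]
    simp only [mul_comm _ (algebraMap B T _), ← Algebra.smul_def,
      mul_comm _ (MvPolynomial.coeff m a), Φ.sum_form_mul_x]
  sum_form_mul_y a := by
    ext m
    simp only [MvPolynomial.coeff_sum, Algebra.smul_def, MvPolynomial.algebraMap_def,
      mul_comm _ (MvPolynomial.C _), MvPolynomial.coeff_C_mul, MvPolynomial.coeff_map,
      coeff_mvPolynomialForm]
    simp only [mul_comm _ (algebraMap B T _), ← Algebra.smul_def,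
      mul_comm _ (MvPolynomial.coeff m a), Φ.sum_form_mul_y]

end Systems

/-! ### Extensions of a module by itself -/

section SelfExtensions

open scoped TensorProduct

/-- There is a short exact sequence `0 → M → P → M → 0` with `P` of projective dimension at most
`n`. -/
def HasSelfExtension {T : Type u} [CommRing T] (n : ℕ) (M : ModuleCat.{u} T) : Prop :=
  ∃ (P : ModuleCat.{u} T) (f : M →ₗ[T] P) (g : P →ₗ[T] M),
    Function.Injective f ∧ Function.Exact f g ∧ Function.Surjective g ∧
      HasProjectiveDimensionLE P n

/-- On a module over `K[X]/(X ^ 2)` there is a `K`-linear involution which anticommutes with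
multiplication by `X`: the identity on the kernel of `X` and `-1` on a complement. -/
theorem exists_involution_anticommuting {K : Type u} [Field K] {M : Type u} [AddCommGroup M]
    [Module K M] (τ : M →ₗ[K] M) (hτ : τ ∘ₗ τ = 0) :
    ∃ σ : M →ₗ[K] M, (∀ m, σ (σ m) = m) ∧ ∀ m, σ (τ m) = -τ (σ m) := by
  obtain ⟨π, hπ⟩ := LinearMap.exists_leftInverse_of_injective (LinearMap.ker τ).subtype
    (Submodule.ker_subtype _)
  have hker : ∀ m, τ (π m : M) = 0 := fun m => (π m).2
  have hfix : ∀ m, τ m = 0 → (π m : M) = m := fun m hm =>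
    congrArg Subtype.val (DFunLike.congr_fun hπ ⟨m, hm⟩)
  have hππ : ∀ m, (π (π m : M) : M) = π m := fun m => hfix _ (hker m)
  let ψ : M →ₗ[K] M := (LinearMap.ker τ).subtype ∘ₗ π
  have hψ : ∀ m, ψ m = π m := fun m => rfl
  refine ⟨ψ + ψ - LinearMap.id, fun m => ?_, fun m => ?_⟩
  · simp only [LinearMap.sub_apply, LinearMap.add_apply, LinearMap.id_apply, map_sub, map_add,
      hψ, hππ]
    abel
  · have := hfix (τ m) (DFunLike.congr_fun hτ m)
    simp only [LinearMap.sub_apply, LinearMap.add_apply, LinearMap.id_apply, map_sub, map_add,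
      hψ, hker, this]
    abel

/-- Let `A` be a `K`-algebra with basis `1, t`, where `t ^ 2 = 0`. Then every `A`-module is
isomorphic to the kernel of the multiplication map from its induced module: that kernel is the
module twisted by `t ↦ -t`. The basis is recorded by the coefficient `φ` of `t`. -/
theorem hasSelfExtension_of_sq_zero {K A : Type u} [Field K] [CommRing A] [Algebra K A]
    (φ : A →ₗ[K] K) {t : A} (ht : t * t = 0) (hφ₁ : φ 1 = 0) (hφt : φ t = 1)
    (hφ : ∀ a, φ a • t + φ (a * t) • 1 = a) (M : ModuleCat.{u} A) : HasSelfExtension 0 M := by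
  let _ : Module K M := Module.compHom M (algebraMap K A)
  have : IsScalarTower K A M := .of_algebraMap_smul fun _ _ => rfl
  obtain ⟨σ, hσ, hσt⟩ := exists_involution_anticommuting
    ((LinearMap.lsmul A M t).restrictScalars K) (by
      ext m
      change t • t • m = 0
      rw [smul_smul, ht, zero_smul])
  change ∀ m, σ (t • m) = -(t • σ m) at hσt
  let μ : A ⊗[K] M →ₗ[A] M := LinearMap.liftBaseChange A (LinearMap.id : M →ₗ[K] M)
  let ε : A ⊗[K] M →ₗ[K] M := (TensorProduct.lid K M).toLinearMap ∘ₗ φ.rTensor M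
  have hεt : ∀ a m, ε (a ⊗ₜ m) = φ a • m := fun a m => by simp [ε]
  let κ : M →ₗ[K] A ⊗[K] M := TensorProduct.mk K A M t -
    TensorProduct.mk K A M 1 ∘ₗ (LinearMap.lsmul A M t).restrictScalars K
  have hκ : ∀ m, κ m = t ⊗ₜ m - 1 ⊗ₜ (t • m) := fun m => rfl
  have hμκ : ∀ m, μ (κ m) = 0 := fun m => by simp [hκ, μ]
  have hκt : ∀ m, κ (t • m) = -(t • κ m) := by
    intro m
    simp only [hκ, smul_sub, TensorProduct.smul_tmul', smul_eq_mul, ht, mul_one, smul_smul]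
    simp
  have hε : ∀ m, ε (κ m) = m := fun m => by
    rw [hκ, map_sub, hεt, hεt, hφ₁, hφt, one_smul, zero_smul, sub_zero]
  -- every tensor has the form `t ⊗ c + 1 ⊗ d`
  have hz : ∀ z : A ⊗[K] M, t ⊗ₜ ε z + 1 ⊗ₜ ε (t • z) = z := by
    intro z
    induction z with
    | zero => simp
    | add z w hz hw =>
      conv_rhs => rw [← hz, ← hw]
      simp only [smul_add, map_add, TensorProduct.tmul_add]
      abel
    | tmul a m =>
      rw [TensorProduct.smul_tmul', hεt, hεt, ← TensorProduct.smul_tmul, ← TensorProduct.smul_tmul,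
        ← TensorProduct.add_tmul, smul_eq_mul, mul_comm t a, hφ]
  have hlin : ∀ (a : A) (m : M), κ (σ (a • m)) = a • κ (σ m) := by
    intro a m
    rw [← hφ a]
    simp only [add_smul, smul_assoc, one_smul, map_add, map_smul, hσt, hκt, map_neg, neg_neg]
  have hf : Function.Injective (fun m => κ (σ m)) := fun m m' h => by
    have : σ m = σ m' := by rw [← hε (σ m), ← hε (σ m')]; exact congrArg _ h
    rw [← hσ m, this, hσ]
  refine ⟨ModuleCat.of A (A ⊗[K] M), { κ ∘ₗ σ with map_smul' := hlin }, μ, hf,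
    fun z => ⟨fun h => ?_, ?_⟩, fun m => ⟨1 ⊗ₜ m, by simp [μ]⟩,
    hasProjectiveDimensionLE_of_projective 0⟩
  · refine ⟨σ (ε z), ?_⟩
    change κ (σ (σ _)) = z
    have h' : ε (t • z) = -(t • ε z) := by
      rw [← hz z] at h
      simp only [μ, map_add, LinearMap.liftBaseChange_tmul, LinearMap.id_apply, one_smul] at h
      exact eq_neg_of_add_eq_zero_right h
    rw [hσ, hκ]
    conv_rhs => rw [← hz z, h', TensorProduct.tmul_neg, ← sub_eq_add_neg]
  · rintro ⟨m, rfl⟩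
    exact hμκ (σ m)

theorem hasSelfExtension_truncPoly (K : Type u) [Field K] (M : ModuleCat.{u} (TruncPoly K 2)) :
    HasSelfExtension 0 M := by
  refine hasSelfExtension_of_sq_zero (truncForm K 1) (t := truncX K 2) ?_ ?_ ?_ (fun a => ?_) M
  · rw [← pow_two]
    exact Ideal.Quotient.eq_zero_iff_mem.2 (Ideal.mem_span_singleton_self _)
  · change (1 : Polynomial K).coeff 1 = 0
    simp [Polynomial.coeff_one]
  · exact Polynomial.coeff_X_one
  · have := sum_truncForm_smul K 1 a
    rw [Fin.sum_univ_two] at this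
    simpa [add_comm] using this

theorem HasSelfExtension.of_linearEquiv {T : Type u} [CommRing T] {n : ℕ} {M N : ModuleCat.{u} T}
    (e : M ≃ₗ[T] N) (h : HasSelfExtension n M) : HasSelfExtension n N := by
  obtain ⟨P, f, g, hf, hfg, hg, hP⟩ := h
  refine ⟨P, f ∘ₗ e.symm.toLinearMap, e.toLinearMap ∘ₗ g, hf.comp e.symm.injective, fun x => ?_,
    e.surjective.comp hg, hP⟩
  simp only [LinearMap.comp_apply, LinearEquiv.coe_coe, EmbeddingLike.map_eq_zero_iff, hfg x,
    LinearMap.coe_comp, e.symm.surjective.range_comp]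

theorem HasSelfExtension.prod {T : Type u} [CommRing T] {n : ℕ} {M N : Type u} [AddCommGroup M]
    [AddCommGroup N] [Module T M] [Module T N] (hM : HasSelfExtension n (ModuleCat.of T M))
    (hN : HasSelfExtension n (ModuleCat.of T N)) : HasSelfExtension n (ModuleCat.of T (M × N)) := by
  obtain ⟨P, f, g, hf, hfg, hg, hP⟩ := hM
  obtain ⟨Q, f', g', hf', hfg', hg', hQ⟩ := hN
  refine ⟨ModuleCat.of T (P × Q), f.prodMap f', g.prodMap g', hf.prodMap hf', ?_,
    hg.prodMap hg', hasProjectiveDimensionLE_middle (f := LinearMap.inl T P Q)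
      (g := LinearMap.snd T P Q) LinearMap.inl_injective Function.Exact.inl_snd
      LinearMap.snd_surjective n hP hQ⟩
  rintro ⟨x, y⟩
  have hx := hfg x
  have hy := hfg' y
  simp only [Set.mem_range] at hx hy
  simp [Prod.ext_iff, hx, hy]

theorem HasSelfExtension.restrict {T A : Type u} [CommRing T] [CommRing A] [Algebra T A]
    [Module.Projective T A] {n : ℕ} {M : Type u} [AddCommGroup M] [Module T M] [Module A M]
    [IsScalarTower T A M] (h : HasSelfExtension n (ModuleCat.of A M)) :
    HasSelfExtension n (ModuleCat.of T M) := by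
  obtain ⟨P, f, g, hf, hfg, hg, hP⟩ := h
  let _ : Module T P := Module.compHom P (algebraMap T A)
  have : IsScalarTower T A P := .of_algebraMap_smul fun _ _ => rfl
  exact ⟨ModuleCat.of T P, f.restrictScalars T, g.restrictScalars T, hf, hfg, hg,
    hasProjectiveDimensionLE_restrict (T := A) n P hP⟩

theorem hasSelfExtension_of_hasProjectiveDimensionLE {T : Type u} [CommRing T] {n : ℕ}
    {M : ModuleCat.{u} T} (h : HasProjectiveDimensionLE M n) : HasSelfExtension n M :=
  ⟨ModuleCat.of T (M × M), LinearMap.inl T M M, LinearMap.snd T M M, LinearMap.inl_injective,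
    Function.Exact.inl_snd, LinearMap.snd_surjective,
    hasProjectiveDimensionLE_middle (f := LinearMap.inl T M M) (g := LinearMap.snd T M M)
      LinearMap.inl_injective Function.Exact.inl_snd LinearMap.snd_surjective n h h⟩

theorem HasSelfExtension.mono {T : Type u} [CommRing T] {m n : ℕ} (hmn : m ≤ n)
    {M : ModuleCat.{u} T} (h : HasSelfExtension m M) : HasSelfExtension n M :=
  let ⟨P, f, g, hf, hfg, hg, hP⟩ := h
  ⟨P, f, g, hf, hfg, hg, hasProjectiveDimensionLE_of_le P hmn hP⟩

theorem IsProductDecomposition.hasSelfExtension {T A S : Type u} [CommRing T] [CommRing A]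
    [CommRing S] [Algebra T A] [Algebra T S] (h : IsProductDecomposition T A S) {n : ℕ}
    (hA : ∀ M : ModuleCat.{u} A, HasSelfExtension 0 M)
    (hS : ∀ M : ModuleCat.{u} S, HasProjectiveDimensionLE M n) (M : ModuleCat.{u} T) :
    HasSelfExtension n M := by
  have := h.projective_left
  have := h.projective_right
  refine HasSelfExtension.of_linearEquiv (M := ModuleCat.of T ((A ⊗[T] M) × (S ⊗[T] M)))
    (h.moduleEquiv M).symm (HasSelfExtension.prod ?_ ?_)
  · exact ((hA (ModuleCat.of A (A ⊗[T] M))).mono n.zero_le).restrict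
  · exact (hasSelfExtension_of_hasProjectiveDimensionLE
      (hS (ModuleCat.of S (S ⊗[T] M)))).restrict

variable {B T : Type u} [CommRing B] [CommRing T] [Algebra B T] (Φ : FrobeniusSystem B T) {n : ℕ}
  (hB : ∀ N : ModuleCat.{u} B, HasProjectiveDimensionLE N n)
  (hT : ∀ M : ModuleCat.{u} T, HasSelfExtension n M)
include Φ hB hT

theorem FrobeniusSystem.isSG : IsSG T n := fun M => ⟨hT M, Φ.subsingleton_ext hB M⟩

theorem FrobeniusSystem.isWSG : IsWSG T n := fun M => by
  obtain ⟨P, f, g, hf, hfg, hg, hP⟩ := hT M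
  exact ⟨⟨P, f, g, hf, hfg, hg, hasFlatDimensionLE_of_hasProjectiveDimensionLE hP⟩, fun I hI =>
    isZero_leftDerived_of_hasProjectiveDimensionLE _
      (Φ.hasProjectiveDimensionLE_of_injective hB I hI)⟩

end SelfExtensions

/-! ### Coresolutions of Gorenstein projective and Gorenstein flat modules -/

section Coresolutions

variable {T : Type u} [CommRing T]

/-- A Gorenstein projective module embeds in a projective module with Gorenstein projective
cokernel. -/
theorem IsGorensteinProjective.exists_coresolution {G : ModuleCat.{u} T}
    (hG : IsGorensteinProjective T G) :
    ∃ (P G' : ModuleCat.{u} T) (f : G →ₗ[T] P) (g : P →ₗ[T] G'), Module.Projective T P ∧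
      IsGorensteinProjective T G' ∧ Function.Injective f ∧ Function.Exact f g ∧
      Function.Surjective g := by
  obtain ⟨P, d, hP, hd, hQ, ⟨e⟩⟩ := hG
  refine ⟨P (0 + 1), ModuleCat.of T (LinearMap.range (d (0 + 1))),
    (LinearMap.range (d 0)).subtype ∘ₗ e.toLinearMap, (d (0 + 1)).rangeRestrict, hP _,
    ⟨fun i => P (i + 1), fun i => d (i + 1), fun i => hP _, fun i => hd _, fun Q h i => hQ Q h _,
      ⟨LinearEquiv.refl _ _⟩⟩, (Submodule.subtype_injective _).comp e.injective, ?_,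
    (d (0 + 1)).surjective_rangeRestrict⟩
  rw [LinearMap.exact_iff, LinearMap.ker_rangeRestrict, LinearMap.exact_iff.1 (hd 0),
    LinearEquiv.range_comp, Submodule.range_subtype]

/-- A Gorenstein flat module embeds in a flat module with Gorenstein flat cokernel. -/
theorem IsGorensteinFlat.exists_coresolution {G : ModuleCat.{u} T}
    (hG : IsGorensteinFlat T G) :
    ∃ (F G' : ModuleCat.{u} T) (f : G →ₗ[T] F) (g : F →ₗ[T] G'), Module.Flat T F ∧
      IsGorensteinFlat T G' ∧ Function.Injective f ∧ Function.Exact f g ∧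
      Function.Surjective g := by
  obtain ⟨P, d, hP, hd, hQ, ⟨e⟩⟩ := hG
  refine ⟨P (0 + 1), ModuleCat.of T (LinearMap.range (d (0 + 1))),
    (LinearMap.range (d 0)).subtype ∘ₗ e.toLinearMap, (d (0 + 1)).rangeRestrict, hP _,
    ⟨fun i => P (i + 1), fun i => d (i + 1), fun i => hP _, fun i => hd _, fun Q h i => hQ Q h _,
      ⟨LinearEquiv.refl _ _⟩⟩, (Submodule.subtype_injective _).comp e.injective, ?_,
    (d (0 + 1)).surjective_rangeRestrict⟩
  rw [LinearMap.exact_iff, LinearMap.ker_rangeRestrict, LinearMap.exact_iff.1 (hd 0),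
    LinearEquiv.range_comp, Submodule.range_subtype]

theorem exists_hasResolutionLE_of_resolutionDim_lt {C : ModuleCat.{u} T → Prop}
    {M : ModuleCat.{u} T} {n : ℕ} (h : resolutionDim T C M < n) :
    ∃ k < n, HasResolutionLE T C k M := by
  simp only [resolutionDim, iInf_lt_iff, Nat.cast_lt] at h
  obtain ⟨k, hk, hkn⟩ := h
  exact ⟨k, hkn, hk⟩

end Coresolutions

/-! ### Vanishing of Ext below the length of a regular sequence -/

section ExtVanishing

open Abelian Pointwise

variable {T : Type u} [CommRing T]

/-- Rees' argument: if `M` is killed by a weakly `F`-regular sequence of length `n`, then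
`Ext^i(M, F) = 0` for `i < n`. Multiplication by an element of the sequence is zero on `Ext(M, F)`,
so that `Ext^(i+1)(M, F)` is a quotient of `Ext^i(M, F / xF)`. -/
theorem subsingleton_ext_of_isWeaklyRegular {M : ModuleCat.{u} T} (rs : List T)
    (hM : ∀ r ∈ rs, ∀ m : M, r • m = 0) (F : ModuleCat.{u} T)
    (hF : RingTheory.Sequence.IsWeaklyRegular F rs) (i : ℕ) (hi : i < rs.length) :
    Subsingleton (Ext.{u} M F i) := by
  induction rs generalizing F i with
  | nil => simp at hi
  | cons r rs ih =>
    rw [RingTheory.Sequence.isWeaklyRegular_cons_iff] at hF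
    have hrM : r • 𝟙 M = 0 := by
      ext m
      exact hM r (by simp) m
    have hker : ∀ x : Ext.{u} M F i, x.comp (Ext.mk₀ (r • 𝟙 F)) (add_zero i) = 0 := by
      intro x
      rw [Ext.mk₀_smul, Ext.comp_smul, Ext.comp_mk₀_id]
      have : r • (Ext.mk₀ (𝟙 M)).comp x (zero_add i) = 0 := by
        rw [← Ext.smul_comp, ← Ext.mk₀_smul, hrM, Ext.mk₀_zero, Ext.zero_comp]
      rwa [Ext.mk₀_id_comp] at this
    have hS := hF.1.smulShortComplex_shortExact (M := F)
    refine subsingleton_of_forall_eq 0 fun x => ?_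
    cases i with
    | zero =>
      have := hS.mono_f
      refine Ext.postcomp_mk₀_injective_of_mono M (ModuleCat.smulShortComplex F r).f
        ((hker x).trans (AddMonoidHom.map_zero _).symm)
    | succ i =>
      have := ih (fun r hr => hM r (List.mem_cons_of_mem _ hr))
        (ModuleCat.of T (QuotSMulTop r F)) hF.2 i (by simpa using hi)
      obtain ⟨y, rfl⟩ := Ext.covariant_sequence_exact₁ M hS x (hker x) rfl
      have hy : y = 0 := Subsingleton.elim (α := Ext.{u} M (ModuleCat.of T (QuotSMulTop r F)) i) _ _
      rw [hy, Ext.zero_comp]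
      rfl

variable {M : ModuleCat.{u} T} {n : ℕ} {C : ModuleCat.{u} T → Prop}

/-- Vanishing of `Ext^i(M, F)` for `i < n` and `F` in some class passes to modules with an
infinite coresolution by modules of that class. -/
theorem subsingleton_ext_of_coresolution
    (hC : ∀ G, C G → ∃ (F G' : ModuleCat.{u} T) (f : G →ₗ[T] F) (g : F →ₗ[T] G'),
      (∀ i < n, Subsingleton (Ext.{u} M F i)) ∧ C G' ∧ Function.Injective f ∧
      Function.Exact f g ∧ Function.Surjective g)
    (i : ℕ) (hi : i < n) (G : ModuleCat.{u} T) (hG : C G) : Subsingleton (Ext.{u} M G i) := by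
  induction i generalizing G with
  | zero =>
    obtain ⟨F, G', f, g, hF, hG', hf, hfg, hg⟩ := hC G hG
    have hF := hF 0 hi
    have : Mono (ModuleCat.ofHom f) := (ModuleCat.mono_iff_injective _).2 hf
    exact (Ext.postcomp_mk₀_injective_of_mono M (ModuleCat.ofHom f)).subsingleton
  | succ i ih =>
    obtain ⟨F, G', f, g, hF, hG', hf, hfg, hg⟩ := hC G hG
    have hF := hF (i + 1) hi
    have := ih (by lia) G' hG'
    refine subsingleton_of_forall_eq 0 fun x => ?_
    obtain ⟨y, rfl⟩ := Ext.covariant_sequence_exact₁ M (shortExact_mk hf hfg hg) x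
      (hF.elim _ _) rfl
    rw [Subsingleton.elim y 0, Ext.zero_comp]

theorem subsingleton_ext_of_hasResolutionLE
    (hC : ∀ i < n, ∀ G, C G → Subsingleton (Ext.{u} M G i)) (k : ℕ) (N : ModuleCat.{u} T)
    (hN : HasResolutionLE T C k N) (i : ℕ) (hi : i + k < n) : Subsingleton (Ext.{u} M N i) := by
  induction k generalizing N i with
  | zero => exact hC i hi N hN
  | succ k ih =>
    obtain ⟨X, p, hX, hp, hK⟩ := hN
    have h₁ := ih _ hK (i + 1) (by lia)
    have h₂ := hC i (by lia) X hX
    refine subsingleton_of_forall_eq 0 fun x => ?_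
    obtain ⟨y, rfl⟩ := Ext.covariant_sequence_exact₃ M
      (shortExact_mk (Submodule.subtype_injective _) (exact_ker_subtype p) hp) x rfl (h₁.elim _ _)
    rw [h₂.elim y 0, Ext.zero_comp]

end ExtVanishing

/-! ### Lower bounds for polynomial rings -/

section PolynomialLowerBound

open Abelian

variable (A : Type u) [CommRing A] (n : ℕ)

/-- The variables form a weakly regular sequence on every flat module over a polynomial ring. -/
theorem isWeaklyRegular_X (F : Type u) [AddCommGroup F] [Module (MvPolynomial (Fin n) A) F]
    [Module.Flat (MvPolynomial (Fin n) A) F] : RingTheory.Sequence.IsWeaklyRegular F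
      (List.ofFn (MvPolynomial.X : Fin n → MvPolynomial (Fin n) A)) := by
  have key : RingTheory.Sequence.IsWeaklyRegular (MvPolynomial (Fin n) A)
      (List.ofFn (MvPolynomial.X : Fin n → MvPolynomial (Fin n) A)) := by
    refine ⟨fun i hi => ?_⟩
    have hin : i < n := by simpa using hi
    -- the quotient by the first `i` variables is a quotient by an ideal of monomials, and the next
    -- variable divides none of them
    have hI : Ideal.ofList ((List.ofFn (MvPolynomial.X : Fin n → MvPolynomial (Fin n) A)).take i) =
        Ideal.span (MvPolynomial.X '' {j : Fin n | (j : ℕ) < i}) := by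
      refine congrArg Ideal.span (Set.ext fun q => ?_)
      change q ∈ List.take i _ ↔ _
      simp only [List.mem_take_iff_getElem, List.getElem_ofFn, List.length_ofFn, Set.mem_image]
      constructor
      · rintro ⟨j, hj, rfl⟩
        exact ⟨⟨j, by lia⟩, show j < i by lia, rfl⟩
      · rintro ⟨j, hj, rfl⟩
        have hj : (j : ℕ) < i := hj
        exact ⟨j, by lia, rfl⟩
    rw [hI, smul_eq_mul, Ideal.mul_top, isSMulRegular_quotient_iff_mem_of_smul_mem,
      List.getElem_ofFn]
    intro p hp
    rw [smul_eq_mul, MvPolynomial.mem_ideal_span_X_image] at hp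
    rw [MvPolynomial.mem_ideal_span_X_image]
    intro m hm
    obtain ⟨j, hj, hmj⟩ := hp (Finsupp.single ⟨i, hin⟩ 1 + m) (by
      rw [MvPolynomial.mem_support_iff, MvPolynomial.coeff_X_mul]
      exact MvPolynomial.mem_support_iff.1 hm)
    refine ⟨j, hj, ?_⟩
    have hne : (⟨i, hin⟩ : Fin n) ≠ j := by
      rintro rfl
      exact lt_irrefl i hj
    simpa [Finsupp.single_apply, hne] using hmj
  exact ((TensorProduct.rid _ F).isWeaklyRegular_congr _).1
    (key.isWeaklyRegular_lTensor (M₂ := F))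

/-- A class of modules which embed in flat modules with cokernel in the class gives resolutions
of length at least `n` for the quotient of a polynomial ring by its `n` variables. -/
theorem le_of_hasResolutionLE_quotient_X [Nontrivial A]
    {C : ModuleCat.{u} (MvPolynomial (Fin n) A) → Prop}
    (hC : ∀ G, C G → ∃ (F G' : ModuleCat.{u} (MvPolynomial (Fin n) A))
      (f : G →ₗ[MvPolynomial (Fin n) A] F) (g : F →ₗ[MvPolynomial (Fin n) A] G'),
      Module.Flat (MvPolynomial (Fin n) A) F ∧ C G' ∧ Function.Injective f ∧
      Function.Exact f g ∧ Function.Surjective g) (k : ℕ)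
    (hk : HasResolutionLE (MvPolynomial (Fin n) A) C k (ModuleCat.of (MvPolynomial (Fin n) A)
      (MvPolynomial (Fin n) A ⧸ Ideal.span (Set.range
        (MvPolynomial.X : Fin n → MvPolynomial (Fin n) A))))) : n ≤ k := by
  by_contra! hkn
  set I := Ideal.span (Set.range (MvPolynomial.X : Fin n → MvPolynomial (Fin n) A))
  have hkill : ∀ r ∈ List.ofFn (MvPolynomial.X : Fin n → MvPolynomial (Fin n) A),
      ∀ m : MvPolynomial (Fin n) A ⧸ I, r • m = 0 := by
    intro r hr m
    obtain ⟨j, rfl⟩ := (List.mem_ofFn' _ _).1 hr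
    obtain ⟨q, rfl⟩ := Ideal.Quotient.mk_surjective m
    change Ideal.Quotient.mk I (MvPolynomial.X j * q) = 0
    rw [Ideal.Quotient.eq_zero_iff_mem]
    exact Ideal.mul_mem_right _ _ (Ideal.subset_span ⟨j, rfl⟩)
  have hExt := subsingleton_ext_of_hasResolutionLE (M := ModuleCat.of _ (_ ⧸ I)) (n := n)
    (fun i hi G hG => subsingleton_ext_of_coresolution (C := C) (fun G hG => by
      obtain ⟨F, G', f, g, hF, h⟩ := hC G hG
      exact ⟨F, G', f, g, fun i hi => subsingleton_ext_of_isWeaklyRegular _ hkill F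
        (isWeaklyRegular_X A n F) i (by simpa using hi), h⟩) i hi G hG) k _ hk 0 (by lia)
  -- the identity of the nonzero module `A[X₁, …, Xₙ] / I` is a nonzero element of `Ext^0`
  have hid := (Ext.mk₀_bijective _ _).1
    (hExt.elim (Ext.mk₀ (𝟙 (ModuleCat.of _ (_ ⧸ I)))) (Ext.mk₀ 0))
  have h1 : (1 : MvPolynomial (Fin n) A ⧸ I) = 0 :=
    congrArg (fun φ : ModuleCat.of (MvPolynomial (Fin n) A) (_ ⧸ I) ⟶ _ =>
      φ.hom (1 : MvPolynomial (Fin n) A ⧸ I)) hid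
  rw [← map_one (Ideal.Quotient.mk I), Ideal.Quotient.eq_zero_iff_mem] at h1
  have hle : I ≤ RingHom.ker (MvPolynomial.constantCoeff (σ := Fin n) (R := A)) := by
    rw [Ideal.span_le]
    rintro _ ⟨j, rfl⟩
    simp
  simpa using hle h1

theorem le_Ggldim_mvPolynomial [Nontrivial A] : n ≤ Ggldim (MvPolynomial (Fin n) A) := by
  by_contra! h
  obtain ⟨k, hk, hres⟩ := exists_hasResolutionLE_of_resolutionDim_lt
    (lt_of_le_of_lt (le_iSup (gorensteinProjectiveDimension _) _) h)
  refine absurd (le_of_hasResolutionLE_quotient_X A n (fun G hG => ?_) k hres) hk.not_ge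
  obtain ⟨F, G', f, g, hF, h⟩ := IsGorensteinProjective.exists_coresolution hG
  exact ⟨F, G', f, g, inferInstance, h⟩

theorem le_wGgldim_mvPolynomial [Nontrivial A] : n ≤ wGgldim (MvPolynomial (Fin n) A) := by
  by_contra! h
  obtain ⟨k, hk, hres⟩ := exists_hasResolutionLE_of_resolutionDim_lt
    (lt_of_le_of_lt (le_iSup (gorensteinFlatDimension _) _) h)
  exact absurd (le_of_hasResolutionLE_quotient_X A n
    (fun G hG => IsGorensteinFlat.exists_coresolution hG) k hres) hk.not_ge

end PolynomialLowerBound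

/-! ### Lower bound for products -/

section ProductLowerBound

open scoped TensorProduct

theorem hasProjectiveDimensionLE_of_gldim_eq {S : Type u} [CommRing S] {n : ℕ}
    (hS : gldim S = n) (N : ModuleCat.{u} S) : HasProjectiveDimensionLE N n :=
  (projectiveDimension_le_iff N n).1
    (hS ▸ le_iSup (fun N : ModuleCat.{u} S => projectiveDimension N) N)

variable {T S : Type u} [CommRing T] [CommRing S] [Algebra T S] [Module.Flat T S]

/-- If `S` has finite global dimension and is flat over `T`, then Gorenstein projective
`T`-modules become projective over `S`, being arbitrarily high syzygies. -/
theorem IsGorensteinProjective.projective_baseChange {n : ℕ}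
    (hS : ∀ N : ModuleCat.{u} S, HasProjectiveDimensionLE N n) (G : ModuleCat.{u} T)
    (hG : IsGorensteinProjective T G) : Module.Projective S (S ⊗[T] G) := by
  -- as every such module is a syzygy of another one, a bound common to all of them can be lowered
  have key : ∀ m : ℕ, (∀ G : ModuleCat.{u} T, IsGorensteinProjective T G →
      HasProjectiveDimensionLE (ModuleCat.of S (S ⊗[T] G)) m) →
      ∀ G : ModuleCat.{u} T, IsGorensteinProjective T G →
      HasProjectiveDimensionLE (ModuleCat.of S (S ⊗[T] G)) 0 := by
    intro m
    induction m with
    | zero => exact id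
    | succ m ih =>
      refine fun h => ih fun G hG => ?_
      obtain ⟨P, G', f, g, hP, hG', hf, hfg, hg⟩ := hG.exists_coresolution
      exact hasProjectiveDimensionLE_left (f := f.baseChange S) (g := g.baseChange S)
        (Module.Flat.lTensor_preserves_injective_linearMap (M := S) f hf)
        (lTensor_exact S hfg hg) (LinearMap.lTensor_surjective S hg) m
        (hasProjectiveDimensionLE_of_projective _) (h G' hG')
  exact (hasProjectiveDimensionLE_zero_iff _).1 (key n (fun G _ => hS _) G hG)

/-- A resolution of an `S`-module by Gorenstein projective `T`-modules becomes a projective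
resolution after base change to `S`. -/
theorem le_Ggldim_of_gldim_eq (hs : Function.Surjective (algebraMap T S)) {n : ℕ}
    (hS : gldim S = n) : n ≤ Ggldim T := by
  have hpd := hasProjectiveDimensionLE_of_gldim_eq hS
  by_contra! h
  obtain ⟨m, rfl⟩ : ∃ m, n = m + 1 := Nat.exists_eq_succ_of_ne_zero (by rintro rfl; simp at h)
  have hle : gldim S ≤ m := by
    refine iSup_le fun N => (projectiveDimension_le_iff N m).2 ?_
    let _ : Module T N := Module.compHom N (algebraMap T S)
    have : IsScalarTower T S N := .of_algebraMap_smul fun _ _ => rfl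
    obtain ⟨k, hk, hres⟩ := exists_hasResolutionLE_of_resolutionDim_lt
      (lt_of_le_of_lt (le_iSup (gorensteinProjectiveDimension T) (ModuleCat.of T N)) h)
    have hk' := hasProjectiveDimensionLE_baseChange_of_hasResolutionLE (T := S)
      (fun G hG => IsGorensteinProjective.projective_baseChange hpd G hG) k _ hres
    let e := baseChangeEquivOfSurjective hs N
    exact hasProjectiveDimensionLE_of_le N (Nat.lt_succ_iff.1 hk)
      (hasProjectiveDimensionLE_of_retract (M₁ := N) e.symm.toLinearMap e.toLinearMap
        (LinearMap.ext e.apply_symm_apply) k hk')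
  rw [hS] at hle
  have : ((m + 1 : ℕ) : ℕ∞) ≤ (m : ℕ) := by exact_mod_cast hle
  exact absurd (Nat.cast_le.1 this) (by lia)

end ProductLowerBound

/-! ### The rings built from truncated polynomial rings -/

section Examples

variable (K : Type u) [Field K]

theorem wdim_eq_zero_of_isSemisimpleRing (R : Type u) [CommRing R] [IsSemisimpleRing R] :
    wdim R = 0 := by
  refine nonpos_iff_eq_zero.1 (iSup_le fun M => iInf₂_le 0 ?_)
  have := Module.projective_of_isSemisimpleRing R M
  exact (inferInstance : Module.Flat R M)

theorem wdim_truncPoly (m : ℕ) : wdim (TruncPoly K (m + 2)) = ⊤ :=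
  wdim_eq_top_of_isExactPairOn (isExactPairOn_truncX (m + 1)) (dvd_pow_self _ (by lia))
    (not_isUnit_truncX (by lia))

theorem isQuasiFrobenius_truncPoly (m : ℕ) : IsQuasiFrobenius (TruncPoly K (m + 1)) :=
  ⟨inferInstance, FrobeniusSystem.injective_self (truncSystem K m)⟩

theorem not_isSemisimpleRing_truncPoly (m : ℕ) : ¬ IsSemisimpleRing (TruncPoly K (m + 2)) := by
  intro h
  have := wdim_eq_zero_of_isSemisimpleRing (TruncPoly K (m + 2))
  rw [wdim_truncPoly] at this
  simp at this

theorem hasProjectiveDimensionLE_field (n : ℕ) (M : ModuleCat.{u} K) :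
    HasProjectiveDimensionLE M n :=
  hasProjectiveDimensionLE_of_projective (M₁ := M) n

theorem Ggldim_truncPoly (m : ℕ) : Ggldim (TruncPoly K (m + 1)) = 0 :=
  nonpos_iff_eq_zero.1 ((truncSystem K m).Ggldim_le (hasProjectiveDimensionLE_field K 0))

theorem isSG_truncPoly_two : IsSG (TruncPoly K 2) 0 :=
  (truncSystem K 1).isSG (hasProjectiveDimensionLE_field K 0) (hasSelfExtension_truncPoly K)

theorem truncX_sq_dvd (m : ℕ) : truncX K (m + 3) ^ 2 ∣ truncX K (m + 3) ^ (m + 2) :=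
  pow_dvd_pow _ (by lia)

theorem not_isSG_truncPoly (m n : ℕ) : ¬ IsSG (TruncPoly K (m + 3)) n :=
  not_isSG_of_isExactPairOn (isExactPairOn_truncX (m + 2)) (truncX_sq_dvd K m)
    (not_isUnit_truncX (by lia)) n

section Product

variable (S : Type u) [CommRing S]

theorem not_isUnit_prod (m : ℕ) : ¬ IsUnit ((truncX K (m + 1), 1) : TruncPoly K (m + 1) × S) :=
  fun h => not_isUnit_truncX (by lia) (h.map (RingHom.fst _ S))

theorem wdim_prod (m : ℕ) : wdim (TruncPoly K (m + 2) × S) = ⊤ :=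
  wdim_eq_top_of_isExactPairOn ((isExactPairOn_truncX (m + 1)).prod S)
    ⟨(truncX K (m + 2) ^ m, 0), by simp [pow_succ']⟩ (not_isUnit_prod K S _)

theorem not_isSG_prod (m n : ℕ) : ¬ IsSG (TruncPoly K (m + 3) × S) n :=
  not_isSG_of_isExactPairOn ((isExactPairOn_truncX (m + 2)).prod S)
    ⟨(truncX K (m + 3) ^ m, 0), by
      rw [Prod.pow_mk, Prod.mk_mul_mk, ← pow_add, mul_zero, add_comm 2 m]⟩ (not_isUnit_prod K S _) n

variable {S}

theorem not_isNoetherianRing_prod (A : Type u) [CommRing A] (h : ¬ IsNoetherianRing S) :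
    ¬ IsNoetherianRing (A × S) :=
  fun _ => h (isNoetherianRing_of_surjective (A × S) S (RingHom.snd A S) Prod.snd_surjective)

variable {n : ℕ} (hS : gldim S = n)
include hS

theorem hasProjectiveDimensionLE_prod (M : ModuleCat.{u} (K × S)) :
    HasProjectiveDimensionLE M n := by
  let _ : Algebra (K × S) K := (RingHom.fst K S).toAlgebra
  let _ : Algebra (K × S) S := (RingHom.snd K S).toAlgebra
  have h : IsProductDecomposition (K × S) K S := Function.bijective_id
  exact h.hasProjectiveDimensionLE (hasProjectiveDimensionLE_field K n)
    (hasProjectiveDimensionLE_of_gldim_eq hS) M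

theorem hasSelfExtension_prod (M : ModuleCat.{u} (TruncPoly K 2 × S)) : HasSelfExtension n M := by
  let _ : Algebra (TruncPoly K 2 × S) (TruncPoly K 2) := (RingHom.fst _ S).toAlgebra
  let _ : Algebra (TruncPoly K 2 × S) S := (RingHom.snd _ S).toAlgebra
  have h : IsProductDecomposition (TruncPoly K 2 × S) (TruncPoly K 2) S := Function.bijective_id
  exact h.hasSelfExtension (hasSelfExtension_truncPoly K)
    (hasProjectiveDimensionLE_of_gldim_eq hS) M

attribute [local instance] prodAlgebra

theorem isSG_prod : IsSG (TruncPoly K 2 × S) n :=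
  ((truncSystem K 1).prod S).isSG (hasProjectiveDimensionLE_prod K hS) (hasSelfExtension_prod K hS)

theorem isWSG_prod : IsWSG (TruncPoly K 2 × S) n :=
  ((truncSystem K 1).prod S).isWSG (hasProjectiveDimensionLE_prod K hS)
    (hasSelfExtension_prod K hS)

theorem Ggldim_prod (m : ℕ) : Ggldim (TruncPoly K (m + 1) × S) = n := by
  refine le_antisymm (((truncSystem K m).prod S).Ggldim_le (hasProjectiveDimensionLE_prod K hS)) ?_
  let _ : Algebra (TruncPoly K (m + 1) × S) (TruncPoly K (m + 1)) := (RingHom.fst _ S).toAlgebra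
  let _ : Algebra (TruncPoly K (m + 1) × S) S := (RingHom.snd _ S).toAlgebra
  have h : IsProductDecomposition (TruncPoly K (m + 1) × S) (TruncPoly K (m + 1)) S :=
    Function.bijective_id
  have := h.projective_right
  exact le_Ggldim_of_gldim_eq (T := TruncPoly K (m + 1) × S) h.surjective_right hS

end Product

section Polynomial

attribute [local instance] MvPolynomial.algebraMvPolynomial

variable (m n : ℕ)

theorem nontrivial_truncPoly : Nontrivial (TruncPoly K (m + 1)) :=
  nontrivial_of_ne (truncX K (m + 1)) 1 fun h =>
    not_isUnit_truncX (K := K) (m := m + 1) (by lia) (h ▸ isUnit_one)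

theorem Ggldim_mvPolynomial : Ggldim (MvPolynomial (Fin n) (TruncPoly K (m + 1))) = n :=
  have := nontrivial_truncPoly K m
  le_antisymm (((truncSystem K m).mvPolynomial (Fin n)).Ggldim_le
    (hasProjectiveDimensionLE_mvPolynomial K n)) (le_Ggldim_mvPolynomial _ n)

theorem wGgldim_mvPolynomial : wGgldim (MvPolynomial (Fin n) (TruncPoly K (m + 1))) = n :=
  have := nontrivial_truncPoly K m
  le_antisymm (((truncSystem K m).mvPolynomial (Fin n)).wGgldim_le
    (hasProjectiveDimensionLE_mvPolynomial K n)) (le_wGgldim_mvPolynomial _ n)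

theorem not_isUnit_C_truncX : ¬ IsUnit
    (MvPolynomial.C (truncX K (m + 1)) : MvPolynomial (Fin n) (TruncPoly K (m + 1))) := fun h =>
  not_isUnit_truncX (K := K) (m := m + 1) (by lia) (by
    simpa using h.map (MvPolynomial.constantCoeff (σ := Fin n) (R := TruncPoly K (m + 1))))

theorem wdim_mvPolynomial : wdim (MvPolynomial (Fin n) (TruncPoly K (m + 2))) = ⊤ :=
  wdim_eq_top_of_isExactPairOn ((isExactPairOn_truncX (m + 1)).mvPolynomial (Fin n))
    (map_dvd MvPolynomial.C (dvd_pow_self _ (by lia))) (not_isUnit_C_truncX K _ n)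

theorem C_truncX_sq_dvd :
    (MvPolynomial.C (truncX K (m + 3)) : MvPolynomial (Fin n) (TruncPoly K (m + 3))) ^ 2 ∣
      MvPolynomial.C (truncX K (m + 3) ^ (m + 2)) := by
  rw [← map_pow]
  exact map_dvd MvPolynomial.C (truncX_sq_dvd K m)

theorem not_isSG_mvPolynomial (k : ℕ) : ¬ IsSG (MvPolynomial (Fin n) (TruncPoly K (m + 3))) k :=
  not_isSG_of_isExactPairOn ((isExactPairOn_truncX (m + 2)).mvPolynomial (Fin n))
    (C_truncX_sq_dvd K m n) (not_isUnit_C_truncX K _ n) k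

theorem not_isWSG_mvPolynomial (k : ℕ) : ¬ IsWSG (MvPolynomial (Fin n) (TruncPoly K (m + 3))) k :=
  not_isWSG_of_isExactPairOn ((isExactPairOn_truncX (m + 2)).mvPolynomial (Fin n))
    (C_truncX_sq_dvd K m n) (not_isUnit_C_truncX K _ n) k

end Polynomial

end Examples

end StronglyGorenstein

end

open StronglyGorenstein in
theorem mainTheorem8 (K : Type u) [Field K] :
    -- both rings are quasi-Frobenius and not semisimple
    ((IsQuasiFrobenius (TruncPoly K 2) ∧ ¬ IsSemisimpleRing (TruncPoly K 2)) ∧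
      (IsQuasiFrobenius (TruncPoly K 3) ∧ ¬ IsSemisimpleRing (TruncPoly K 3))) ∧
    -- the rings themselves
    (Ggldim (TruncPoly K 2) = 0 ∧ Ggldim (TruncPoly K 3) = 0 ∧
      IsSG (TruncPoly K 2) 0 ∧ ¬ IsSG (TruncPoly K 3) 0) ∧
    -- their products with a non-Noetherian ring of global dimension `n`
    (∀ (n : ℕ) (S : Type u) [CommRing S], ¬ IsNoetherianRing S → gldim S = n →
      (¬ IsNoetherianRing (TruncPoly K 2 × S) ∧ IsSG (TruncPoly K 2 × S) n ∧
        IsWSG (TruncPoly K 2 × S) n ∧ wdim (TruncPoly K 2 × S) = ⊤) ∧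
      (Ggldim (TruncPoly K 3 × S) = n ∧ ¬ IsSG (TruncPoly K 3 × S) n ∧
        ¬ IsNoetherianRing (TruncPoly K 3 × S) ∧ wdim (TruncPoly K 3 × S) = ⊤)) ∧
    -- polynomial rings over `K[X]/(X ^ 3)`
    (∀ n : ℕ,
      wGgldim (MvPolynomial (Fin n) (TruncPoly K 3)) = n ∧
      Ggldim (MvPolynomial (Fin n) (TruncPoly K 3)) = n ∧
      ¬ IsSG (MvPolynomial (Fin n) (TruncPoly K 3)) n ∧
      ¬ IsWSG (MvPolynomial (Fin n) (TruncPoly K 3)) n ∧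
      wdim (MvPolynomial (Fin n) (TruncPoly K 3)) = ⊤) :=
  ⟨⟨⟨isQuasiFrobenius_truncPoly K 1, not_isSemisimpleRing_truncPoly K 0⟩,
      ⟨isQuasiFrobenius_truncPoly K 2, not_isSemisimpleRing_truncPoly K 1⟩⟩,
    ⟨Ggldim_truncPoly K 1, Ggldim_truncPoly K 2, isSG_truncPoly_two K, not_isSG_truncPoly K 0 0⟩,
    fun n S _ hN hS =>
      ⟨⟨not_isNoetherianRing_prod _ hN, isSG_prod K hS, isWSG_prod K hS, wdim_prod K S 0⟩,
        ⟨Ggldim_prod K hS 2, not_isSG_prod K S 0 n, not_isNoetherianRing_prod _ hN,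
          wdim_prod K S 1⟩⟩,
    fun n => ⟨wGgldim_mvPolynomial K 2 n, Ggldim_mvPolynomial K 2 n, not_isSG_mvPolynomial K 0 n n,
      not_isWSG_mvPolynomial K 0 n n, wdim_mvPolynomial K 1 n⟩⟩
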